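/- Let $Y_1,Y_2,\ldots$ be independent random variables with values in $\{0,1\}$ and $p_\ell=\mathbb{P}(Y_\ell=1)\in(0,1)$. Suppose that $(p_\ell)$ is periodic with period length $r\ge 1$, i.e. $r$ is the least positive integer with $p_{mr+\ell}=p_\ell$ for all $\ell,m$. Let $d\ge 1$ be an integer, and put $q=\lfloor (d-1)/2\rfloor$ and $\omega_j=2\pi j/d$. For $1\le i\le d$ let $$Z_i^n=\frac1{\lfloor n/d\rfloor}\sum_{k=0}^{\lfloor n/d\rfloor-1}Y_{i+kd},\qquad e_i=\frac1r\sum_{k=0}^{r-1}p_{i+kd},\qquad v_i=\frac1r\sum_{k=0}^{r-1}\mathrm{Var}(Y_{i+kd}),$$ and $Z^n=(Z_1^n,\ldots,Z_d^n)$. For $x\in\mathbb{R}^d$ let $$I_x(\omega_j)=\frac1d\Bigl|\sum_{\ell=1}^d x_\ell e^{-i\ell\omega_j}\Bigr|^2,\qquad A=\{x\in\mathbb{R}^d : I_x(\omega_1)=\cdots=I_x(\omega_q)=0\},$$ $$g(x)=\frac{\max_{1\le j\le q}I_x(\omega_j)}{\sum_{m=1}^q I_x(\omega_m)},\qquad f(x)=g(x)\,\mathbf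 1_{\{x\notin A\}}.$$ (If $d\le 2$, then $q=0$, $A=\mathbb{R}^d$, and $g$ and $f$ are understood to be identically $0$.) Let $N_1,\ldots,N_d$ be i.i.d. standard normal random variables. Theorem. Suppose that $r$ and $d$ are coprime. Then: (i) $(e_1,\ldots,e_d)\in A$. (ii) $\lim_{n\to\infty}\mathrm{Var}\bigl(\sqrt{\lfloor n/d\rfloor}\,Z_i^n\bigr)=v_i$ for every $1\le i\le d$, and $v_1=\cdots=v_d$. (iii) If $d\ge 3$, then $(N_1,\ldots,N_d)\notin A$ almost surely, so that $g(N_1,\ldots,N_d)$ is almost surely well defined; and $f(Z^n)$ converges in law to $g(N_1,\ldots,N_d)$ as $n\to\infty$. The case $r=1$ is the null hypothesis of a constant success probability, so the limit law is the same as under the null hypothesis. (iv) The test has no asymptotic power: for every $\alpha\in(0,1)$ and every solution $k_\alpha\in\mathbb{R}$ of $$\sum_{j=1}^q(-1)^{j+1}\binom qj(1-jk_\alpha)_+^{q-1}=\alpha$$ (where $x_+=\max\{x,0\}$ and $0^0=1$), the rejection probability satisfies $\mathbb{P}\bigl(f(Z^n)>k_\alpha\bigr)\to\alpha$ as $n\to\infty$.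 -/

import Mathlib

open MeasureTheory ProbabilityTheory Filter Topology
open scoped BigOperators

/-! Sequences are indexed from `0`: `Y ℓ` and `p ℓ` stand for the `(ℓ+1)`-st observation and its
success probability, and the index `i : Fin d` stands for the `(i+1)`-st coordinate. -/

noncomputable section

/-- `r` is the period length of `p`: the least positive integer `s` with
`p (m s + ℓ) = p ℓ` for all `ℓ` and `m`. -/
def IsPeriodLength (p : ℕ → ℝ) (r : ℕ) : Prop :=
  IsLeast {s : ℕ | 0 < s ∧ ∀ ℓ m : ℕ, p (m * s + ℓ) = p ℓ} r

/-- `Y` is an independent sequence of `{0,1}`-valued random variables with success probabilities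
`p ℓ = P(Y ℓ = 1) ∈ (0,1)`, where `p` is periodic with (minimal) period length `r`. -/
structure IsPeriodicBinarySeries {Ω : Type*} [MeasurableSpace Ω] (μ : Measure Ω)
    (Y : ℕ → Ω → ℝ) (p : ℕ → ℝ) (r : ℕ) : Prop where
  measurable : ∀ ℓ, Measurable (Y ℓ)
  indep : iIndepFun Y μ
  binary : ∀ ℓ ω, Y ℓ ω = 0 ∨ Y ℓ ω = 1
  prob_eq : ∀ ℓ, p ℓ = μ.real {ω | Y ℓ ω = 1}
  prob_mem : ∀ ℓ, p ℓ ∈ Set.Ioo (0 : ℝ) 1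
  period : IsPeriodLength p r

/-- The time series `Z^n = (Z_1^n, …, Z_d^n)` of block means. -/
def blockMean {Ω : Type*} (Y : ℕ → Ω → ℝ) (d n : ℕ) (ω : Ω) : Fin d → ℝ :=
  fun i => (1 / ((n / d : ℕ) : ℝ)) * ∑ k ∈ Finset.range (n / d), Y (i + k * d) ω

/-- The limits `e_i = (1/r) ∑_{k<r} p_{i+kd}`. -/
def limitMean (p : ℕ → ℝ) (r d : ℕ) : Fin d → ℝ :=
  fun i => (1 / (r : ℝ)) * ∑ k ∈ Finset.range r, p (i + k * d)

/-- The limiting variances `v_i = (1/r) ∑_{k<r} Var(Y_{i+kd})`. -/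
def limitVariance {Ω : Type*} [MeasurableSpace Ω] (μ : Measure Ω) (Y : ℕ → Ω → ℝ)
    (r d : ℕ) : Fin d → ℝ :=
  fun i => (1 / (r : ℝ)) * ∑ k ∈ Finset.range r, variance (Y (i + k * d)) μ

/-- The number `q = ⌊(d-1)/2⌋` of frequencies (for `d ≥ 1`). -/
def numFreq (d : ℕ) : ℕ := (d - 1) / 2

/-- The Fourier frequency `ω_j = 2πj/d`. -/
def fourierFreq (d j : ℕ) : ℝ := 2 * Real.pi * j / d

/-- The periodogram `I_x(ω_j) = (1/d) |∑_{ℓ=1}^d x_ℓ exp(-i ℓ ω_j)|²`. -/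
def periodogram {d : ℕ} (x : Fin d → ℝ) (j : ℕ) : ℝ :=
  (1 / (d : ℝ)) *
    ‖∑ ℓ : Fin d, (x ℓ : ℂ) *
      Complex.exp (-Complex.I * (((ℓ : ℕ) + 1 : ℕ) : ℂ) * (fourierFreq d j : ℂ))‖ ^ 2

/-- The set `A` of those `x` for which `I_x(ω_1) = … = I_x(ω_q) = 0`. -/
def vanishingSet (d : ℕ) : Set (Fin d → ℝ) :=
  {x | ∀ j ∈ Finset.Icc 1 (numFreq d), periodogram x j = 0}

/-- Fisher's statistic `g(x) = max_{1≤j≤q} I_x(ω_j) / ∑_{m=1}^q I_x(ω_m)`. The supremum runs over a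
finite index set; it is the maximum if `q ≥ 1`, and `0` if `q = 0`. -/
def fisherG {d : ℕ} (x : Fin d → ℝ) : ℝ :=
  (⨆ j : Fin (numFreq d), periodogram x ((j : ℕ) + 1)) /
    ∑ m ∈ Finset.Icc 1 (numFreq d), periodogram x m

open scoped Classical in
/-- The test statistic `f(x) = g(x) 𝟙{x ∉ A}`. -/
def fisherF {d : ℕ} (x : Fin d → ℝ) : ℝ :=
  fisherG x * (if x ∉ vanishingSet d then 1 else 0)

/-- `∑_{j=1}^q (-1)^{j+1} (q choose j) (1 - j k)_+^{q-1}`; the critical value `k_α` of the test is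
the solution `k` of `fisherTail q k = α`. -/
def fisherTail (q : ℕ) (k : ℝ) : ℝ :=
  ∑ j ∈ Finset.Icc 1 q,
    (-1 : ℝ) ^ (j + 1) * (q.choose j : ℝ) * (max (1 - (j : ℝ) * k) 0) ^ (q - 1)

end

/-! The statistic `g` is a quotient of periodogram ordinates at nonzero Fourier frequencies, hence
invariant under adding a constant to all coordinates and under scaling. If `r` and `d` are coprime,
then `k ↦ i + k d` runs through all residues mod `r`, so every coordinate of the block means has
the same limiting mean `e` and the same limiting variance `v`. By the central limit theorem for
sums over full periods and independence of the coordinates, `√⌊n/d⌋ (Z^n - e)` tends in law to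
`√v (N_1, …, N_d)`, and `g` takes the same value at `√⌊n/d⌋ (Z^n - e)` as at `Z^n`. Since `g` is
continuous off the null set `A`, the continuous mapping theorem gives the limit law
`g(N_1, …, N_d)`.

The periodogram ordinates of Gaussian white noise are i.i.d. standard exponential. For such `E_i`
the event that `E_j > k ∑ E_i` for all `j ∈ J` is the preimage of the positive orthant under a
linear map that preserves `∑ E_i` and has determinant `(1 - |J| k)^{1-q}`, so it has probability
`(1 - |J| k)_+^{q-1}`. Inclusion-exclusion over `J` turns this into Fisher's formula for
`P(g(N) > k)`. -/

section Periodogram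

variable {d : ℕ}

lemma sum_exp_fourierFreq (hd : d ≠ 0) (m : ℤ) :
    ∑ l : Fin d, Complex.exp (((((l : ℕ) + 1 : ℕ) : ℝ) * (2 * Real.pi * m / d) : ℝ) * Complex.I)
      = if (d : ℤ) ∣ m then (d : ℂ) else 0 := by
  have hζ := Complex.isPrimitiveRoot_exp d hd
  set ζ := Complex.exp (2 * Real.pi * Complex.I / d)
  have hterm : ∀ l : ℕ, Complex.exp ((((l + 1 : ℕ) : ℝ) * (2 * Real.pi * m / d) : ℝ) * Complex.I)
      = ζ ^ m * (ζ ^ m) ^ l := fun l => by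
    rw [← pow_succ', ← Complex.exp_int_mul, ← Complex.exp_nat_mul]
    congr 1
    push_cast
    ring
  simp_rw [hterm]
  rw [← Finset.mul_sum, Fin.sum_univ_eq_sum_range (fun l => (ζ ^ m) ^ l) d]
  split_ifs with h
  · simp [(hζ.zpow_eq_one_iff_dvd m).mpr h]
  · have hpow : (ζ ^ m) ^ d = 1 := by
      rw [← zpow_natCast, zpow_comm, zpow_natCast, hζ.pow_eq_one, one_zpow]
    rw [geom_sum_eq (mt (hζ.zpow_eq_one_iff_dvd m).mp h), hpow, sub_self, zero_div, mul_zero]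

lemma sum_cos_fourierFreq (hd : d ≠ 0) (m : ℤ) :
    ∑ l : Fin d, Real.cos ((((l : ℕ) + 1 : ℕ) : ℝ) * (2 * Real.pi * m / d))
      = if (d : ℤ) ∣ m then (d : ℝ) else 0 := by
  have h := congrArg Complex.re (sum_exp_fourierFreq hd m)
  simpa only [Complex.re_sum, Complex.exp_ofReal_mul_I_re, apply_ite Complex.re,
    Complex.natCast_re, Complex.zero_re] using h

lemma sum_sin_fourierFreq (hd : d ≠ 0) (m : ℤ) :
    ∑ l : Fin d, Real.sin ((((l : ℕ) + 1 : ℕ) : ℝ) * (2 * Real.pi * m / d)) = 0 := by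
  have h := congrArg Complex.im (sum_exp_fourierFreq hd m)
  simpa only [Complex.im_sum, Complex.exp_ofReal_mul_I_im, apply_ite Complex.im,
    Complex.natCast_im, Complex.zero_im, ite_self] using h

/-- The vectors `(cos (ℓ ω_j))_ℓ` and `(sin (ℓ ω_j))_ℓ`, indexed by `true` and `false`, for the
frequencies `ω_1, …, ω_q`: the index `j : Fin q` stands for `ω_{j+1}`. -/
noncomputable def trigVec (d : ℕ) (a : Fin (numFreq d) × Bool) (l : Fin d) : ℝ :=
  bif a.2 then Real.cos ((((l : ℕ) + 1 : ℕ) : ℝ) * fourierFreq d (a.1 + 1))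
  else Real.sin ((((l : ℕ) + 1 : ℕ) : ℝ) * fourierFreq d (a.1 + 1))

lemma two_mul_succ_lt (j : Fin (numFreq d)) : 2 * ((j : ℕ) + 1) < d := by
  have hj := j.isLt
  unfold numFreq at hj
  omega

lemma sum_trigVec (a : Fin (numFreq d) × Bool) : ∑ l, trigVec d a l = 0 := by
  obtain ⟨j, b⟩ := a
  have hj := two_mul_succ_lt j
  have hndvd : ¬ (d : ℤ) ∣ ((j + 1 : ℕ) : ℤ) := fun h => by
    have := Int.le_of_dvd (by omega) h
    omega
  have hcos := sum_cos_fourierFreq (d := d) (by omega) ((j + 1 : ℕ) : ℤ)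
  have hsin := sum_sin_fourierFreq (d := d) (by omega) ((j + 1 : ℕ) : ℤ)
  rw [if_neg hndvd] at hcos
  cases b
  exacts [hsin, hcos]

lemma sum_trigVec_mul_trigVec (a b : Fin (numFreq d) × Bool) :
    ∑ l, trigVec d a l * trigVec d b l = if a = b then (d : ℝ) / 2 else 0 := by
  obtain ⟨j, s⟩ := a
  obtain ⟨k, t⟩ := b
  have hj := two_mul_succ_lt j
  have hk := two_mul_succ_lt k
  have hd : d ≠ 0 := by omega
  have hadd_ndvd : ¬ (d : ℤ) ∣ ((j + 1 : ℕ) : ℤ) + (k + 1 : ℕ) := fun h => by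
    have := Int.le_of_dvd (by omega) h
    omega
  have hsub_dvd : (d : ℤ) ∣ ((j + 1 : ℕ) : ℤ) - (k + 1 : ℕ) ↔ j = k := by
    refine ⟨fun h => ?_, fun h => by simp [h]⟩
    have := Int.eq_zero_of_abs_lt_dvd h (by rw [abs_lt]; omega)
    omega
  have hadd : ∀ l : ℕ, (l : ℝ) * (2 * Real.pi * ((((j + 1 : ℕ) : ℤ) + (k + 1 : ℕ) : ℤ) : ℝ) / d)
      = l * fourierFreq d (j + 1) + l * fourierFreq d (k + 1) := fun l => by
    unfold fourierFreq; push_cast; ring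
  have hsub : ∀ l : ℕ, (l : ℝ) * (2 * Real.pi * ((((j + 1 : ℕ) : ℤ) - (k + 1 : ℕ) : ℤ) : ℝ) / d)
      = l * fourierFreq d (j + 1) - l * fourierFreq d (k + 1) := fun l => by
    unfold fourierFreq; push_cast; ring
  have hcos_add := sum_cos_fourierFreq hd (((j + 1 : ℕ) : ℤ) + (k + 1 : ℕ))
  have hcos_sub := sum_cos_fourierFreq hd (((j + 1 : ℕ) : ℤ) - (k + 1 : ℕ))
  have hsin_add := sum_sin_fourierFreq hd (((j + 1 : ℕ) : ℤ) + (k + 1 : ℕ))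
  have hsin_sub := sum_sin_fourierFreq hd (((j + 1 : ℕ) : ℤ) - (k + 1 : ℕ))
  simp only [hadd_ndvd, if_false, hadd, Real.cos_add, Real.sin_add, Finset.sum_add_distrib,
    Finset.sum_sub_distrib] at hcos_add hsin_add
  simp only [hsub_dvd, hsub, Real.cos_sub, Real.sin_sub, Finset.sum_add_distrib,
    Finset.sum_sub_distrib] at hcos_sub hsin_sub
  by_cases hjk : j = k <;> cases s <;> cases t <;>
    simp only [trigVec, hjk, cond_true, cond_false, Prod.mk.injEq, true_and, false_and, if_true,
      if_false, reduceCtorEq] at hcos_add hcos_sub hsin_add hsin_sub ⊢ <;>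
    linarith

lemma periodogram_eq (x : Fin d → ℝ) (j : Fin (numFreq d)) :
    periodogram x (j + 1) = (1 / (d : ℝ)) *
      ((∑ l, trigVec d (j, true) l * x l) ^ 2 + (∑ l, trigVec d (j, false) l * x l) ^ 2) := by
  have hexp : ∀ l : Fin d, (x l : ℂ) * Complex.exp (-Complex.I * (((l : ℕ) + 1 : ℕ) : ℂ) *
      (fourierFreq d (j + 1) : ℂ)) =
      ((trigVec d (j, true) l * x l : ℝ) : ℂ)
        + ((-(trigVec d (j, false) l * x l) : ℝ) : ℂ) * Complex.I := fun l => by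
    rw [show -Complex.I * (((l : ℕ) + 1 : ℕ) : ℂ) * (fourierFreq d (j + 1) : ℂ)
      = ((-((((l : ℕ) + 1 : ℕ) : ℝ) * fourierFreq d (j + 1)) : ℝ) : ℂ) * Complex.I by
        push_cast; ring, Complex.exp_mul_I, ← Complex.ofReal_cos, ← Complex.ofReal_sin,
      Real.cos_neg, Real.sin_neg]
    simp only [trigVec, cond_true, cond_false]
    push_cast
    ring
  rw [periodogram]
  simp_rw [hexp]
  rw [Finset.sum_add_distrib, ← Finset.sum_mul, ← Complex.ofReal_sum, ← Complex.ofReal_sum,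
    ← Complex.normSq_eq_norm_sq, Complex.normSq_add_mul_I, Finset.sum_neg_distrib, neg_sq]

lemma periodogram_nonneg (x : Fin d → ℝ) (j : ℕ) : 0 ≤ periodogram x j := by
  unfold periodogram; positivity

@[fun_prop]
lemma continuous_periodogram (j : ℕ) : Continuous fun x : Fin d → ℝ => periodogram x j := by
  unfold periodogram; fun_prop

lemma periodogram_mul_sub_const (x : Fin d → ℝ) (a c : ℝ) (j : Fin (numFreq d)) :
    periodogram (fun i => a * (x i - c)) (j + 1) = a ^ 2 * periodogram x (j + 1) := by
  have hcoeff : ∀ b, ∑ l, trigVec d (j, b) l * (a * (x l - c))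
      = a * ∑ l, trigVec d (j, b) l * x l := fun b =>
    calc ∑ l, trigVec d (j, b) l * (a * (x l - c))
        = a * ∑ l, trigVec d (j, b) l * x l - a * c * ∑ l, trigVec d (j, b) l := by
          rw [Finset.mul_sum, Finset.mul_sum, ← Finset.sum_sub_distrib]
          exact Finset.sum_congr rfl fun l _ => by ring
      _ = a * ∑ l, trigVec d (j, b) l * x l := by rw [sum_trigVec, mul_zero, sub_zero]
  rw [periodogram_eq, periodogram_eq, hcoeff, hcoeff]
  ring

end Periodogram

section FisherStatistic

lemma continuous_iSup_of_finite {ι X : Type*} [Finite ι] [TopologicalSpace X] {f : ι → X → ℝ}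
    (hf : ∀ i, Continuous (f i)) : Continuous fun x => ⨆ i, f i x := by
  have := Fintype.ofFinite ι
  rcases isEmpty_or_nonempty ι with h | h
  · simp only [Real.iSup_of_isEmpty]
    exact continuous_const
  · simp_rw [← Finset.sup'_univ_eq_ciSup]
    exact Continuous.finset_sup'_apply _ fun i _ => hf i

lemma lt_iSup_div_iff {ι : Type*} [Finite ι] [Nonempty ι] {x : ι → ℝ} {s : ℝ} (hs : 0 < s)
    (k : ℝ) : k < (⨆ i, x i) / s ↔ ∃ i, k * s < x i := by
  rw [lt_div_iff₀ hs, lt_ciSup_iff (Set.finite_range _).bddAbove]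

variable {d : ℕ}

lemma sum_Icc_periodogram (x : Fin d → ℝ) :
    ∑ m ∈ Finset.Icc 1 (numFreq d), periodogram x m
      = ∑ j : Fin (numFreq d), periodogram x (j + 1) := by
  rw [Fin.sum_univ_eq_sum_range (fun j => periodogram x (j + 1)) (numFreq d),
    Finset.range_eq_Ico, Finset.sum_Ico_add' (fun j => periodogram x j) 0 (numFreq d) 1]
  rfl

lemma fisherG_eq (x : Fin d → ℝ) :
    fisherG x = (⨆ j : Fin (numFreq d), periodogram x (j + 1)) /
      ∑ j : Fin (numFreq d), periodogram x (j + 1) := by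
  rw [fisherG, sum_Icc_periodogram]

lemma mem_vanishingSet_iff_sum_eq_zero {x : Fin d → ℝ} :
    x ∈ vanishingSet d ↔ ∑ j : Fin (numFreq d), periodogram x (j + 1) = 0 := by
  rw [← sum_Icc_periodogram, Finset.sum_eq_zero_iff_of_nonneg fun j _ => periodogram_nonneg x j]
  rfl

lemma const_mem_vanishingSet (d : ℕ) (c : ℝ) : (fun _ : Fin d => c) ∈ vanishingSet d := by
  simp [mem_vanishingSet_iff_sum_eq_zero, periodogram_eq, ← Finset.sum_mul, sum_trigVec]

lemma fisherG_nonneg (x : Fin d → ℝ) : 0 ≤ fisherG x :=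
  div_nonneg (Real.iSup_nonneg fun _ => periodogram_nonneg _ _)
    (Finset.sum_nonneg fun _ _ => periodogram_nonneg _ _)

lemma fisherG_eq_zero_of_mem_vanishingSet {x : Fin d → ℝ} (hx : x ∈ vanishingSet d) :
    fisherG x = 0 := by
  rw [fisherG_eq, mem_vanishingSet_iff_sum_eq_zero.mp hx, div_zero]

lemma fisherG_eq_zero_of_numFreq_eq_zero (hq : numFreq d = 0) (x : Fin d → ℝ) : fisherG x = 0 :=
  fisherG_eq_zero_of_mem_vanishingSet (by simp [vanishingSet, hq])

lemma fisherF_eq_fisherG (x : Fin d → ℝ) : fisherF x = fisherG x := by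
  by_cases hx : x ∈ vanishingSet d
  · rw [fisherF, fisherG_eq_zero_of_mem_vanishingSet hx, zero_mul]
  · rw [fisherF, if_pos hx, mul_one]

lemma fisherG_mul_sub_const (x : Fin d → ℝ) {a : ℝ} (ha : a ≠ 0) (c : ℝ) :
    fisherG (fun i => a * (x i - c)) = fisherG x := by
  simp_rw [fisherG_eq, periodogram_mul_sub_const]
  rw [← Real.mul_iSup_of_nonneg (sq_nonneg a), ← Finset.mul_sum,
    mul_div_mul_left _ _ (pow_ne_zero 2 ha)]

lemma mul_mem_vanishingSet_iff {x : Fin d → ℝ} {a : ℝ} (ha : a ≠ 0) :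
    (fun i => a * x i) ∈ vanishingSet d ↔ x ∈ vanishingSet d := by
  have h := fun j => periodogram_mul_sub_const x a 0 j
  simp only [sub_zero] at h
  simp_rw [mem_vanishingSet_iff_sum_eq_zero, h, ← Finset.mul_sum]
  exact mul_eq_zero_iff_left (pow_ne_zero 2 ha)

lemma measurable_fisherG : Measurable (fisherG : (Fin d → ℝ) → ℝ) := by
  unfold fisherG
  exact (continuous_iSup_of_finite fun _ => continuous_periodogram _).measurable.div
    (continuous_finsetSum _ fun j _ => continuous_periodogram _).measurable

lemma continuousAt_fisherG {x : Fin d → ℝ} (hx : x ∉ vanishingSet d) :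
    ContinuousAt (fisherG : (Fin d → ℝ) → ℝ) x := by
  rw [mem_vanishingSet_iff_sum_eq_zero] at hx
  rw [funext (fisherG_eq (d := d))]
  exact (continuous_iSup_of_finite fun _ => continuous_periodogram _).continuousAt.div
    (continuous_finsetSum _ fun j _ => continuous_periodogram _).continuousAt hx

lemma lt_fisherG_iff {x : Fin d → ℝ} (hx : x ∉ vanishingSet d) (k : ℝ) :
    k < fisherG x ↔ ∃ i : Fin (numFreq d),
      k * ∑ j : Fin (numFreq d), periodogram x (j + 1) < periodogram x (i + 1) := by
  rw [mem_vanishingSet_iff_sum_eq_zero] at hx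
  obtain ⟨j, -, -⟩ := Finset.exists_ne_zero_of_sum_ne_zero hx
  have := Nonempty.intro j
  rw [fisherG_eq, lt_iSup_div_iff
    ((Finset.sum_nonneg fun j _ => periodogram_nonneg x _).lt_of_ne' hx)]

end FisherStatistic

section PeriodicAverage

variable {b : ℕ → ℝ} {r : ℕ}

lemma sum_range_sub_average (b : ℕ → ℝ) (hr : 0 < r) :
    ∑ k ∈ Finset.range r, (b k - 1 / (r : ℝ) * ∑ k ∈ Finset.range r, b k) = 0 := by
  rw [Finset.sum_sub_distrib, Finset.sum_const, Finset.card_range, nsmul_eq_mul, ← mul_assoc,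
    mul_one_div_cancel (Nat.cast_ne_zero.mpr hr.ne'), one_mul, sub_self]

lemma periodic_sum_range (hb : Function.Periodic b r) (h0 : ∑ k ∈ Finset.range r, b k = 0) :
    Function.Periodic (fun m => ∑ k ∈ Finset.range m, b k) r := fun m => by
  dsimp only
  rw [add_comm m r, Finset.sum_range_add, h0, zero_add]
  exact Finset.sum_congr rfl fun k _ => by rw [add_comm]; exact hb k

lemma exists_abs_le_of_periodic (hr : 0 < r) (hb : Function.Periodic b r) :
    ∃ C, ∀ m, |b m| ≤ C :=
  ⟨∑ k ∈ Finset.range r, |b k|, fun m => by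
    rw [← hb.map_mod_nat m]
    exact Finset.single_le_sum (f := fun k => |b k|) (fun _ _ => abs_nonneg _)
      (Finset.mem_range.mpr (Nat.mod_lt m hr))⟩

lemma tendsto_average_of_periodic (hr : 0 < r) (hb : Function.Periodic b r) :
    Tendsto (fun m : ℕ => 1 / (m : ℝ) * ∑ k ∈ Finset.range m, b k) atTop
      (𝓝 (1 / (r : ℝ) * ∑ k ∈ Finset.range r, b k)) := by
  set e := 1 / (r : ℝ) * ∑ k ∈ Finset.range r, b k
  have hcentred : Function.Periodic (fun k => b k - e) r := fun k => by simp only [hb k]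
  obtain ⟨C, hC⟩ := exists_abs_le_of_periodic hr
    (periodic_sum_range hcentred (sum_range_sub_average b hr))
  have hlim : Tendsto (fun m : ℕ => 1 / (m : ℝ) * C) atTop (𝓝 0) := by
    simpa only [zero_mul] using tendsto_one_div_atTop_nhds_zero_nat.mul_const C
  refine tendsto_sub_nhds_zero_iff.mp (squeeze_zero_norm' ?_ hlim)
  filter_upwards [eventually_gt_atTop 0] with m hm
  have hsum : 1 / (m : ℝ) * ∑ k ∈ Finset.range m, b k - e
      = 1 / (m : ℝ) * ∑ k ∈ Finset.range m, (b k - e) := by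
    rw [Finset.sum_sub_distrib, Finset.sum_const, Finset.card_range, nsmul_eq_mul, mul_sub,
      ← mul_assoc, one_div_mul_cancel (Nat.cast_ne_zero.mpr hm.ne'), one_mul]
  rw [hsum, norm_mul, Real.norm_of_nonneg (by positivity)]
  exact mul_le_mul_of_nonneg_left (hC m) (by positivity)

lemma sum_range_add_mul_of_coprime {d : ℕ} (hr : 0 < r) (hb : Function.Periodic b r)
    (hrd : Nat.Coprime r d) (i : ℕ) :
    ∑ k ∈ Finset.range r, b (i + k * d) = ∑ k ∈ Finset.range r, b k := by
  have hmaps : Set.MapsTo (fun k => (i + k * d) % r) (Finset.range r) (Finset.range r) :=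
    fun _ _ => Finset.mem_coe.mpr (Finset.mem_range.mpr (Nat.mod_lt _ hr))
  have hinj : Set.InjOn (fun k => (i + k * d) % r) (Finset.range r : Set ℕ) := by
    intro k hk l hl h
    have hmod : k * d ≡ l * d [MOD r] := Nat.ModEq.add_left_cancel' i h
    exact (Nat.ModEq.cancel_right_of_coprime hrd hmod).eq_of_lt_of_lt
      (Finset.mem_range.mp hk) (Finset.mem_range.mp hl)
  exact Finset.sum_nbij _ hmaps hinj (Finset.surjOn_of_injOn_of_card_le _ hmaps hinj le_rfl)
    fun k _ => (hb.map_mod_nat _).symm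

end PeriodicAverage

section Independence

variable {Ω : Type*} [MeasurableSpace Ω] {μ : Measure Ω}

lemma iIndepFun_curry {ι κ E : Type*} [Countable ι] [Countable κ] [MeasurableSpace E]
    {X : ι × κ → Ω → E} (hX : iIndepFun X μ) (hm : ∀ a, AEMeasurable (X a) μ) :
    iIndepFun (fun i ω (j : κ) => X (i, j) ω) μ := by
  have := hX.isProbabilityMeasure
  have (i : ι) (j : κ) : IsProbabilityMeasure (μ.map (X (i, j))) :=
    Measure.isProbabilityMeasure_map (hm _)
  have hrow (i : ι) : μ.map (fun ω j => X (i, j) ω)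
      = Measure.infinitePi fun j => μ.map (X (i, j)) :=
    (iIndepFun_iff_map_fun_eq_infinitePi_map₀' fun j => hm (i, j)).mp
      (hX.precomp (Prod.mk_right_injective i))
  rw [iIndepFun_iff_map_fun_eq_infinitePi_map₀' fun i => aemeasurable_pi_lambda _ fun j => hm _]
  simp_rw [hrow]
  rw [← Measure.infinitePi_map_curry,
    ← (iIndepFun_iff_map_fun_eq_infinitePi_map₀' hm).mp hX,
    AEMeasurable.map_map_of_aemeasurable (by fun_prop) (aemeasurable_pi_lambda _ hm)]
  rfl

lemma injective_add_mul (d : ℕ) :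
    Function.Injective fun a : Fin d × ℕ => (a.1 : ℕ) + a.2 * d := by
  rintro ⟨i, k⟩ ⟨j, l⟩ h
  have hmod := congrArg (· % d) h
  have hdiv := congrArg (· / d) h
  simp only [Nat.add_mul_mod_self_right, Nat.mod_eq_of_lt i.isLt, Nat.mod_eq_of_lt j.isLt,
    Nat.add_mul_div_right _ _ i.pos, Nat.div_eq_of_lt i.isLt, Nat.div_eq_of_lt j.isLt,
    zero_add] at hmod hdiv
  exact Prod.ext (Fin.ext hmod) hdiv

lemma sum_range_mul_eq_sum_blocks (f : ℕ → ℝ) (t r : ℕ) :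
    ∑ k ∈ Finset.range (t * r), f k = ∑ u ∈ Finset.range t, ∑ j : Fin r, f (j + u * r) := by
  induction t with
  | zero => simp
  | succ t ih =>
    rw [Finset.sum_range_succ, ← ih, Nat.succ_mul, Finset.sum_range_add,
      Fin.sum_univ_eq_sum_range (fun j => f (j + t * r))]
    simp only [add_comm]

end Independence

/-- An independent sequence of square integrable random variables whose distributions are periodic
in time with period `r`, which need not be the least period. -/
structure IsPeriodicSeries {Ω : Type*} [MeasurableSpace Ω] (μ : Measure Ω) (W : ℕ → Ω → ℝ)
    (r : ℕ) : Prop where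
  pos : 0 < r
  indep : iIndepFun W μ
  memLp : ∀ k, MemLp (W k) 2 μ
  identDistrib : ∀ k, IdentDistrib (W (k + r)) (W k) μ μ

namespace IsPeriodicSeries

variable {Ω : Type*} [MeasurableSpace Ω] {μ : Measure Ω} {W : ℕ → Ω → ℝ} {r : ℕ}

lemma aemeasurable (hW : IsPeriodicSeries μ W r) (k : ℕ) : AEMeasurable (W k) μ :=
  (hW.memLp k).aestronglyMeasurable.aemeasurable

lemma periodic_integral (hW : IsPeriodicSeries μ W r) :
    Function.Periodic (fun k => ∫ ω, W k ω ∂μ) r :=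
  fun k => (hW.identDistrib k).integral_eq

lemma periodic_variance (hW : IsPeriodicSeries μ W r) :
    Function.Periodic (fun k => Var[W k; μ]) r :=
  fun k => (hW.identDistrib k).variance_eq

lemma identDistrib_add_mul (hW : IsPeriodicSeries μ W r) (k m : ℕ) :
    IdentDistrib (W (k + m * r)) (W k) μ μ := by
  induction m with
  | zero => simpa using IdentDistrib.refl (hW.aemeasurable k)
  | succ m ih =>
    rw [Nat.succ_mul, ← add_assoc]
    exact (hW.identDistrib _).trans ih

lemma progression (hW : IsPeriodicSeries μ W r) (i : ℕ) {d : ℕ} (hd : 0 < d) :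
    IsPeriodicSeries μ (fun k => W (i + k * d)) r where
  pos := hW.pos
  indep := hW.indep.precomp fun k l h => Nat.eq_of_mul_eq_mul_right hd (Nat.add_left_cancel h)
  memLp _ := hW.memLp _
  identDistrib k := by
    rw [add_mul, ← add_assoc, mul_comm r d]
    exact hW.identDistrib_add_mul _ d

lemma sub_const (hW : IsPeriodicSeries μ W r) (c : ℝ) :
    IsPeriodicSeries μ (fun k ω => W k ω - c) r where
  pos := hW.pos
  indep := hW.indep.comp (fun _ x => x - c) fun _ => by fun_prop
  memLp k := by
    have := hW.indep.isProbabilityMeasure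
    exact (hW.memLp k).sub (memLp_const c)
  identDistrib k := (hW.identDistrib k).comp (by fun_prop : Measurable fun x : ℝ => x - c)

lemma iIndepFun_blockSum (hW : IsPeriodicSeries μ W r) :
    iIndepFun (fun u ω => ∑ j : Fin r, W (j + u * r) ω) μ := by
  have hpair : iIndepFun (fun (a : ℕ × Fin r) => W (a.2 + a.1 * r)) μ :=
    hW.indep.precomp ((injective_add_mul r).comp Prod.swap_injective)
  exact (iIndepFun_curry hpair fun _ => hW.aemeasurable _).comp (fun _ x => ∑ j, x j)
    fun _ => by fun_prop

lemma identDistrib_blockSum (hW : IsPeriodicSeries μ W r) (u : ℕ) :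
    IdentDistrib (fun ω => ∑ j : Fin r, W (j + u * r) ω) (fun ω => ∑ j : Fin r, W (j + 0 * r) ω)
      μ μ := by
  have hrow (v : ℕ) : iIndepFun (fun j : Fin r => W (j + v * r)) μ :=
    hW.indep.precomp fun i j h => Fin.ext (Nat.add_right_cancel h)
  have hident (j : Fin r) : IdentDistrib (W (j + u * r)) (W (j + 0 * r)) μ μ :=
    (hW.identDistrib_add_mul j u).trans (hW.identDistrib_add_mul j 0).symm
  exact (IdentDistrib.pi hident (hrow u) (hrow 0)).comp
    (by fun_prop : Measurable fun x : Fin r → ℝ => ∑ j, x j)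

lemma integrable (hW : IsPeriodicSeries μ W r) (k : ℕ) : Integrable (W k) μ := by
  have := hW.indep.isProbabilityMeasure
  exact (hW.memLp k).integrable one_le_two

lemma variance_sum_range (hW : IsPeriodicSeries μ W r) (m : ℕ) :
    Var[fun ω => ∑ k ∈ Finset.range m, W k ω; μ] = ∑ k ∈ Finset.range m, Var[W k; μ] := by
  rw [← IndepFun.variance_sum (fun k _ => hW.memLp k)
    fun k _ l _ hkl => hW.indep.indepFun hkl]
  congr 1
  ext ω
  simp

end IsPeriodicSeries

section ConvergenceInDistribution

variable {ι κ E F : Type*} {Ω : ι → Type*} {Ω' Ω'' : Type*} {mΩ : ∀ i, MeasurableSpace (Ω i)}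
  [MeasurableSpace Ω'] [MeasurableSpace Ω''] {μ : ∀ i, Measure (Ω i)}
  [∀ i, IsProbabilityMeasure (μ i)] {μ' : Measure Ω'} [IsProbabilityMeasure μ']
  {μ'' : Measure Ω''} [IsProbabilityMeasure μ''] {l : Filter ι} {l' : Filter κ}
  [TopologicalSpace E] [MeasurableSpace E] [OpensMeasurableSpace E]
  [TopologicalSpace F] [MeasurableSpace F] [OpensMeasurableSpace F] {Z : Ω' → E}

lemma tendstoInDistribution_comp_tendsto {X : (i : ι) → Ω i → E}
    (h : TendstoInDistribution X l Z μ μ') {φ : κ → ι} (hφ : Tendsto φ l' l) :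
    TendstoInDistribution (fun k => X (φ k)) l' Z (fun k => μ (φ k)) μ' where
  forall_aemeasurable k := h.forall_aemeasurable (φ k)
  aemeasurable_limit := h.aemeasurable_limit
  tendsto := h.tendsto.comp hφ

lemma tendstoInDistribution_comp_of_ae_continuousAt [HasOuterApproxClosed E]
    [HasOuterApproxClosed F] [l.IsCountablyGenerated] {X : (i : ι) → Ω i → E}
    (h : TendstoInDistribution X l Z μ μ') {g : E → F} (hg : Measurable g)
    (hcont : ∀ᵐ ω ∂μ', ContinuousAt g (Z ω)) :
    TendstoInDistribution (fun i ω => g (X i ω)) l (fun ω => g (Z ω)) μ μ' where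
  forall_aemeasurable i := hg.comp_aemeasurable (h.forall_aemeasurable i)
  aemeasurable_limit := hg.comp_aemeasurable h.aemeasurable_limit
  tendsto := by
    have hgX (i : ι) : AEMeasurable (fun ω => g (X i ω)) (μ i) :=
      hg.comp_aemeasurable (h.forall_aemeasurable i)
    have hgZ : AEMeasurable (fun ω => g (Z ω)) μ' := hg.comp_aemeasurable h.aemeasurable_limit
    refine tendsto_of_forall_isClosed_limsup_le' fun C hC => ?_
    have hclosure := ProbabilityMeasure.limsup_measure_closed_le_of_tendsto h.tendsto
      (isClosed_closure (s := g ⁻¹' C))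
    simp only [ProbabilityMeasure.coe_mk] at hclosure ⊢
    rw [Measure.map_apply_of_aemeasurable h.aemeasurable_limit
      isClosed_closure.measurableSet] at hclosure
    rw [Measure.map_apply_of_aemeasurable hgZ hC.measurableSet]
    have hsource (i : ι) :
        (μ i).map (fun ω => g (X i ω)) C ≤ (μ i).map (X i) (closure (g ⁻¹' C)) := by
      rw [Measure.map_apply_of_aemeasurable (hgX i) hC.measurableSet,
        Measure.map_apply_of_aemeasurable (h.forall_aemeasurable i)
          isClosed_closure.measurableSet]
      exact measure_mono fun ω hω => subset_closure hω
    have hlimit : μ' (Z ⁻¹' closure (g ⁻¹' C)) ≤ μ' ((fun ω => g (Z ω)) ⁻¹' C) := by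
      refine measure_mono_ae ?_
      filter_upwards [hcont] with ω hω hmem
      exact closure_minimal (Set.image_preimage_subset g C) hC (mem_closure_image hω hmem)
    exact (limsup_le_limsup (Eventually.of_forall hsource)).trans (hclosure.trans hlimit)

lemma tendsto_measureReal_gt_of_tendstoInDistribution {X : (i : ι) → Ω i → ℝ} {Z : Ω' → ℝ}
    (h : TendstoInDistribution X l Z μ μ') {k : ℝ} (hk : μ' {ω | Z ω = k} = 0) :
    Tendsto (fun i => (μ i).real {ω | X i ω > k}) l (𝓝 (μ'.real {ω | Z ω > k})) := by
  have hfrontier : μ'.map Z (frontier (Set.Ioi k)) = 0 := by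
    rwa [frontier_Ioi, Measure.map_apply_of_aemeasurable h.aemeasurable_limit
      (measurableSet_singleton k)]
  have htail := ProbabilityMeasure.tendsto_measure_of_null_frontier_of_tendsto' h.tendsto hfrontier
  simp only [ProbabilityMeasure.coe_mk,
    Measure.map_apply_of_aemeasurable h.aemeasurable_limit measurableSet_Ioi,
    Measure.map_apply_of_aemeasurable (h.forall_aemeasurable _) measurableSet_Ioi] at htail
  exact (ENNReal.tendsto_toReal (measure_ne_top _ _)).comp htail

lemma tendstoInDistribution_mul_of_tendsto [l.IsCountablyGenerated] {X : ι → Ω'' → ℝ} {Z : Ω' → ℝ}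
    {c : ι → ℝ} {a : ℝ} (h : TendstoInDistribution X l Z (fun _ => μ'') μ')
    (hc : Tendsto c l (𝓝 a)) :
    TendstoInDistribution (fun i ω => c i * X i ω) l (fun ω => a * Z ω) (fun _ => μ'') μ' := by
  have hmeasure : TendstoInMeasure μ'' (fun i _ => c i) l fun _ => a := fun ε hε => by
    refine tendsto_const_nhds.congr' ?_
    filter_upwards [hc.eventually (Metric.eball_mem_nhds a hε)] with i hi
    simp only [not_le.mpr (Metric.mem_eball.mp hi), Set.ofPred_false, measure_empty]
  exact h.continuous_comp_prodMk_of_tendstoInMeasure_const (g := fun x : ℝ × ℝ => x.2 * x.1)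
    (by fun_prop) hmeasure fun _ => aemeasurable_const

lemma tendstoInDistribution_pi {J : Type*} [Finite J] {β : J → Type*}
    [∀ j, TopologicalSpace (β j)] [∀ j, SecondCountableTopology (β j)]
    [∀ j, TopologicalSpace.PseudoMetrizableSpace (β j)] [∀ j, MeasurableSpace (β j)]
    [∀ j, OpensMeasurableSpace (β j)] {X : (j : J) → (i : ι) → Ω i → β j} {Z : (j : J) → Ω' → β j}
    (h : ∀ j, TendstoInDistribution (X j) l (Z j) μ μ')
    (hX : ∀ i, iIndepFun (fun j => X j i) (μ i)) (hZ : iIndepFun Z μ') :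
    TendstoInDistribution (fun i ω j => X j i ω) l (fun ω j => Z j ω) μ μ' where
  forall_aemeasurable i := aemeasurable_pi_lambda _ fun j => (h j).forall_aemeasurable i
  aemeasurable_limit := aemeasurable_pi_lambda _ fun j => (h j).aemeasurable_limit
  tendsto := by
    have := Fintype.ofFinite J
    have hpi := (ProbabilityMeasure.continuous_pi.tendsto _).comp
      (tendsto_pi_nhds.mpr fun j => (h j).tendsto)
    convert! hpi using 2
    · congr 1
      exact funext fun i => Subtype.ext
        ((hX i).map_fun_eq_pi_map fun j => (h j).forall_aemeasurable i)
    · exact congrArg 𝓝 (Subtype.ext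
        (hZ.map_fun_eq_pi_map fun j => (h j).aemeasurable_limit))

end ConvergenceInDistribution

lemma tendsto_inv_sqrt_natCast : Tendsto (fun m : ℕ => (√(m : ℝ))⁻¹) atTop (𝓝 0) :=
  tendsto_inv_atTop_zero.comp (Real.tendsto_sqrt_atTop.comp tendsto_natCast_atTop_atTop)

lemma tendsto_inv_sqrt_mul_sqrt_div {r : ℕ} (hr : 0 < r) :
    Tendsto (fun m : ℕ => (√(m : ℝ))⁻¹ * √((m / r : ℕ) : ℝ)) atTop (𝓝 (√(r : ℝ))⁻¹) := by
  have hdiv : Tendsto (fun m : ℕ => ((m / r : ℕ) : ℝ) / m) atTop (𝓝 (r : ℝ)⁻¹) := by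
    have h := (tendsto_nat_floor_mul_div_atTop (R := ℝ) (a := (r : ℝ)⁻¹) (by positivity)).comp
      tendsto_natCast_atTop_atTop
    refine h.congr fun m => ?_
    simp only [Function.comp_apply, inv_mul_eq_div, Nat.floor_div_eq_div]
  have h := (Real.continuous_sqrt.tendsto _).comp hdiv
  rw [Real.sqrt_inv] at h
  refine h.congr fun m => ?_
  rw [Function.comp_apply, Real.sqrt_div' _ (Nat.cast_nonneg m), div_eq_inv_mul]

namespace IsPeriodicSeries

variable {Ω : Type*} [MeasurableSpace Ω] {μ : Measure Ω} {W : ℕ → Ω → ℝ} {r : ℕ}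

lemma eLpNorm_sum_incomplete_block_le (hW : IsPeriodicSeries μ W r) (m : ℕ) :
    eLpNorm (fun ω => ∑ j ∈ Finset.range (m % r), W (j + m / r * r) ω) 1 μ
      ≤ ∑ j ∈ Finset.range r, eLpNorm (W j) 1 μ :=
  calc eLpNorm (fun ω => ∑ j ∈ Finset.range (m % r), W (j + m / r * r) ω) 1 μ
      = eLpNorm (∑ j ∈ Finset.range (m % r), W (j + m / r * r)) 1 μ := by
        congr 1; ext ω; simp
    _ ≤ ∑ j ∈ Finset.range (m % r), eLpNorm (W (j + m / r * r)) 1 μ :=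
        eLpNorm_sum_le (fun j _ => (hW.memLp _).aestronglyMeasurable) le_rfl
    _ = ∑ j ∈ Finset.range (m % r), eLpNorm (W j) 1 μ :=
        Finset.sum_congr rfl fun j _ => (hW.identDistrib_add_mul j _).eLpNorm_eq 1
    _ ≤ ∑ j ∈ Finset.range r, eLpNorm (W j) 1 μ :=
        Finset.sum_le_sum_of_subset (Finset.range_subset_range.mpr (Nat.mod_lt m hW.pos).le)

lemma tendstoInMeasure_incomplete_block (hW : IsPeriodicSeries μ W r) :
    TendstoInMeasure μ
      (fun (m : ℕ) ω => (√(m : ℝ))⁻¹ * ∑ j ∈ Finset.range (m % r), W (j + m / r * r) ω)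
      atTop fun _ => 0 := by
  set C := ∑ j ∈ Finset.range r, eLpNorm (W j) 1 μ
  have hC : C ≠ ⊤ := ENNReal.sum_ne_top.mpr fun j _ =>
    (memLp_one_iff_integrable.mpr (hW.integrable j)).eLpNorm_ne_top
  have hlim : Tendsto (fun m : ℕ => ‖(√(m : ℝ))⁻¹‖ₑ * C) atTop (𝓝 0) := by
    simpa only [enorm_zero, zero_mul] using
      ENNReal.Tendsto.mul_const tendsto_inv_sqrt_natCast.enorm (Or.inr hC)
  have hmeas (m : ℕ) :
      AEMeasurable (fun ω => (√(m : ℝ))⁻¹ * ∑ j ∈ Finset.range (m % r), W (j + m / r * r) ω) μ :=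
    (Finset.aemeasurable_fun_sum _ fun _ _ => hW.aemeasurable _).const_mul _
  refine tendstoInMeasure_of_tendsto_eLpNorm one_ne_zero
    (fun m => (hmeas m).aestronglyMeasurable) aestronglyMeasurable_const
    (tendsto_of_tendsto_of_tendsto_of_le_of_le tendsto_const_nhds hlim (fun _ => zero_le)
      fun m => ?_)
  simp only [Pi.sub_def, sub_zero]
  exact (eLpNorm_const_smul_le (c := (√(m : ℝ))⁻¹)).trans
    (mul_le_mul_right (hW.eLpNorm_sum_incomplete_block_le m) _)

variable {Ω' : Type*} [MeasurableSpace Ω'] {ν : Measure Ω'} {G : Ω' → ℝ}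

lemma tendstoInDistribution_complete_blocks [IsProbabilityMeasure μ] [IsProbabilityMeasure ν]
    (hW : IsPeriodicSeries μ W r) (hmean : ∑ k ∈ Finset.range r, ∫ ω, W k ω ∂μ = 0)
    (hG : HasLaw G (gaussianReal 0 (1 / (r : ℝ) * ∑ k ∈ Finset.range r, Var[W k; μ]).toNNReal) ν) :
    TendstoInDistribution
      (fun (m : ℕ) ω => (√(m : ℝ))⁻¹ * ∑ k ∈ Finset.range (m / r * r), W k ω)
      atTop G (fun _ => μ) ν := by
  have hr : (0 : ℝ) < r := Nat.cast_pos.mpr hW.pos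
  set B := fun (u : ℕ) ω => ∑ j : Fin r, W (j + u * r) ω
  have hB0 : B 0 = fun ω => ∑ k ∈ Finset.range r, W k ω := by
    ext ω
    simp only [B, zero_mul, add_zero, Fin.sum_univ_eq_sum_range (fun k => W k ω)]
  have hBint : ∫ ω, B 0 ω ∂μ = 0 := by
    rw [hB0, integral_finsetSum _ fun k _ => hW.integrable k, hmean]
  have hrG : HasLaw (fun ω => √(r : ℝ) * G ω) (gaussianReal 0 Var[B 0; μ].toNNReal) ν := by
    convert! gaussianReal_const_mul hG √(r : ℝ) using 1
    rw [hB0, hW.variance_sum_range, mul_zero]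
    congr 1
    ext
    rw [NNReal.coe_mul, NNReal.coe_mk, Real.coe_toNNReal', Real.coe_toNNReal', Real.sq_sqrt hr.le,
      mul_max_of_nonneg _ _ hr.le, mul_zero, ← mul_assoc, mul_one_div_cancel hr.ne', one_mul]
  have hblocks := tendstoInDistribution_mul_of_tendsto
    (tendstoInDistribution_comp_tendsto
      (tendstoInDistribution_inv_sqrt_mul_sum_sub hrG (memLp_finsetSum _ fun j _ => hW.memLp _)
        hW.iIndepFun_blockSum hW.identDistrib_blockSum)
      (Nat.tendsto_div_const_atTop hW.pos.ne'))
    (tendsto_inv_sqrt_mul_sqrt_div hW.pos)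
  refine hblocks.congr (fun m => .of_forall fun ω => ?_) (.of_forall fun ω => ?_)
  · beta_reduce
    rw [hBint, mul_zero, sub_zero, sum_range_mul_eq_sum_blocks]
    rcases Nat.eq_zero_or_pos (m / r) with hm | hm
    · simp only [hm, Finset.range_zero, Finset.sum_empty, mul_zero]
    · rw [mul_assoc, mul_inv_cancel_left₀ (by positivity)]
  · exact inv_mul_cancel_left₀ (by positivity) _

lemma tendstoInDistribution_inv_sqrt_mul_sum [IsProbabilityMeasure μ] [IsProbabilityMeasure ν]
    (hW : IsPeriodicSeries μ W r) (hmean : ∑ k ∈ Finset.range r, ∫ ω, W k ω ∂μ = 0)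
    (hG : HasLaw G (gaussianReal 0 (1 / (r : ℝ) * ∑ k ∈ Finset.range r, Var[W k; μ]).toNNReal) ν) :
    TendstoInDistribution (fun (m : ℕ) ω => (√(m : ℝ))⁻¹ * ∑ k ∈ Finset.range m, W k ω)
      atTop G (fun _ => μ) ν := by
  have hmeas (m : ℕ) :
      AEMeasurable (fun ω => (√(m : ℝ))⁻¹ * ∑ j ∈ Finset.range (m % r), W (j + m / r * r) ω) μ :=
    (Finset.aemeasurable_fun_sum _ fun _ _ => hW.aemeasurable _).const_mul _
  refine ((hW.tendstoInDistribution_complete_blocks hmean hG).add_of_tendstoInMeasure_const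
    hW.tendstoInMeasure_incomplete_block hmeas).congr (fun m => .of_forall fun ω => ?_)
    (.of_forall fun ω => add_zero _)
  beta_reduce
  conv_rhs => rw [← Nat.div_add_mod' m r, Finset.sum_range_add, mul_add, Nat.div_add_mod']
  simp only [Pi.add_apply, add_comm]

lemma tendstoInDistribution_inv_sqrt_mul_sum_sub [IsProbabilityMeasure μ] [IsProbabilityMeasure ν]
    (hW : IsPeriodicSeries μ W r)
    (hG : HasLaw G (gaussianReal 0 (1 / (r : ℝ) * ∑ k ∈ Finset.range r, Var[W k; μ]).toNNReal) ν) :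
    TendstoInDistribution
      (fun (m : ℕ) ω => (√(m : ℝ))⁻¹ * (∑ k ∈ Finset.range m, W k ω
        - m * (1 / (r : ℝ) * ∑ k ∈ Finset.range r, ∫ ω, W k ω ∂μ)))
      atTop G (fun _ => μ) ν := by
  set e := 1 / (r : ℝ) * ∑ k ∈ Finset.range r, ∫ ω, W k ω ∂μ
  have hmean : ∑ k ∈ Finset.range r, ∫ ω, W k ω - e ∂μ = 0 := by
    simp only [integral_sub (hW.integrable _) (integrable_const e), integral_const, probReal_univ,
      one_smul]
    exact sum_range_sub_average _ hW.pos
  have hvar (k : ℕ) : Var[fun ω => W k ω - e; μ] = Var[W k; μ] :=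
    variance_sub_const (hW.aemeasurable k).aestronglyMeasurable e
  have h := (hW.sub_const e).tendstoInDistribution_inv_sqrt_mul_sum hmean
    (by simpa only [hvar] using hG)
  simpa only [Finset.sum_sub_distrib, Finset.sum_const, Finset.card_range, nsmul_eq_mul] using h

end IsPeriodicSeries

section BlockMean

variable {Ω : Type*} [MeasurableSpace Ω] {μ : Measure Ω} {Y : ℕ → Ω → ℝ} {r d : ℕ}

lemma limitMean_eq_average_of_coprime {p : ℕ → ℝ} (hr : 0 < r) (hp : Function.Periodic p r)
    (hrd : Nat.Coprime r d) :
    limitMean p r d = fun _ => 1 / (r : ℝ) * ∑ k ∈ Finset.range r, p k :=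
  funext fun i => by rw [limitMean, sum_range_add_mul_of_coprime hr hp hrd]

namespace IsPeriodicSeries

lemma limitVariance_eq_average (hY : IsPeriodicSeries μ Y r) (hrd : Nat.Coprime r d) :
    limitVariance μ Y r d = fun _ => 1 / (r : ℝ) * ∑ k ∈ Finset.range r, Var[Y k; μ] :=
  limitMean_eq_average_of_coprime hY.pos hY.periodic_variance hrd

lemma tendsto_variance_sqrt_mul_blockMean (hY : IsPeriodicSeries μ Y r) (hd : 0 < d) (i : Fin d) :
    Tendsto (fun n : ℕ => Var[fun ω => √((n / d : ℕ) : ℝ) * blockMean Y d n ω i; μ]) atTop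
      (𝓝 (limitVariance μ Y r d i)) := by
  have hYi := hY.progression i hd
  have hvar (m : ℕ) :
      Var[fun ω => √(m : ℝ) * (1 / (m : ℝ) * ∑ k ∈ Finset.range m, Y (i + k * d) ω); μ]
        = 1 / (m : ℝ) * ∑ k ∈ Finset.range m, Var[Y (i + k * d); μ] := by
    rw [variance_const_mul, variance_const_mul, hYi.variance_sum_range, Real.sq_sqrt m.cast_nonneg]
    rcases Nat.eq_zero_or_pos m with rfl | hm
    · simp only [Finset.range_zero, Finset.sum_empty, mul_zero]
    · field
  exact ((tendsto_average_of_periodic hY.pos hYi.periodic_variance).comp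
    (Nat.tendsto_div_const_atTop hd.ne')).congr fun n => (hvar (n / d)).symm

lemma iIndepFun_blockMean (hY : IsPeriodicSeries μ Y r) (n : ℕ) :
    iIndepFun (fun i ω => blockMean Y d n ω i) μ := by
  have hpair : iIndepFun (fun (a : Fin d × ℕ) => Y (a.1 + a.2 * d)) μ :=
    hY.indep.precomp (injective_add_mul d)
  exact (iIndepFun_curry hpair fun _ => hY.aemeasurable _).comp
    (fun _ y => 1 / ((n / d : ℕ) : ℝ) * ∑ k ∈ Finset.range (n / d), y k) fun _ => by fun_prop

variable {Ω' : Type*} [MeasurableSpace Ω'] {ν : Measure Ω'}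

lemma tendstoInDistribution_blockMean [IsProbabilityMeasure μ] [IsProbabilityMeasure ν]
    (hY : IsPeriodicSeries μ Y r) (hd : 0 < d) {G : Fin d → Ω' → ℝ} (hG : iIndepFun G ν)
    (hG' : ∀ i, HasLaw (G i) (gaussianReal 0 (limitVariance μ Y r d i).toNNReal) ν) :
    TendstoInDistribution
      (fun (n : ℕ) ω i => √((n / d : ℕ) : ℝ)
        * (blockMean Y d n ω i - limitMean (fun ℓ => ∫ ω, Y ℓ ω ∂μ) r d i))
      atTop (fun ω i => G i ω) (fun _ => μ) ν := by
  refine tendstoInDistribution_pi (fun i => ?_)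
    (fun n => (hY.iIndepFun_blockMean n).comp (fun i z => √((n / d : ℕ) : ℝ)
      * (z - limitMean (fun ℓ => ∫ ω, Y ℓ ω ∂μ) r d i)) fun _ => by fun_prop) hG
  refine (tendstoInDistribution_comp_tendsto
    ((hY.progression i hd).tendstoInDistribution_inv_sqrt_mul_sum_sub (hG' i))
    (Nat.tendsto_div_const_atTop hd.ne')).congr (fun n => .of_forall fun ω => ?_) .rfl
  change (√((n / d : ℕ) : ℝ))⁻¹ * (∑ k ∈ Finset.range (n / d), Y (i + k * d) ω
      - ((n / d : ℕ) : ℝ) * limitMean (fun ℓ => ∫ ω, Y ℓ ω ∂μ) r d i) = _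
  unfold blockMean
  rcases Nat.eq_zero_or_pos (n / d) with hm | hm
  · simp only [hm, Nat.cast_zero, Real.sqrt_zero, inv_zero, zero_mul]
  · have hm : (0 : ℝ) < (n / d : ℕ) := Nat.cast_pos.mpr hm
    field_simp
    rw [Real.sq_sqrt hm.le]

end IsPeriodicSeries

end BlockMean

section ExponentialLaw

lemma expMeasure_eq_withDensity (r : ℝ) :
    expMeasure r = (volume.restrict (Set.Ioi 0)).withDensity
      fun x => ENNReal.ofReal (r * Real.exp (-(r * x))) := by
  rw [restrict_Ioi_eq_restrict_Ici, ← withDensity_indicator measurableSet_Ici]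
  change volume.withDensity (exponentialPDF r) = _
  congr 1
  ext x
  simp only [exponentialPDF_eq, Set.indicator_apply, Set.mem_Ici]
  split_ifs <;> simp only [ENNReal.ofReal_zero]

lemma charFun_expMeasure {r : ℝ} (hr : 0 < r) (t : ℝ) :
    charFun (expMeasure r) t = r / (r - t * Complex.I) := by
  have hre : (t * Complex.I - r).re < 0 := by simpa using hr
  have hexp (x : ℝ) :
      (ENNReal.ofReal (r * Real.exp (-(r * x)))).toReal • Complex.exp (t * x * Complex.I)
        = r * Complex.exp ((t * Complex.I - r) * x) := by
    rw [ENNReal.toReal_ofReal (by positivity), Complex.real_smul]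
    push_cast
    rw [mul_assoc, ← Complex.exp_add]
    ring_nf
  rw [charFun_apply_real, expMeasure_eq_withDensity, integral_withDensity_eq_integral_toReal_smul
    (by fun_prop) (.of_forall fun _ => ENNReal.ofReal_lt_top)]
  simp_rw [hexp]
  rw [integral_const_mul, integral_exp_mul_complex_Ioi hre, Complex.ofReal_zero, mul_zero,
    Complex.exp_zero, neg_div, ← div_neg, neg_sub, mul_one_div]

lemma sq_charFun_map_half_sq_gaussianReal (t : ℝ) :
    charFun ((gaussianReal 0 1).map fun x => x ^ 2 / 2) t ^ 2 = 1 / (1 - t * Complex.I) := by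
  have hre : 0 < ((1 - t * Complex.I) / 2).re := by simp
  have hexp (x : ℝ) : gaussianPDFReal 0 1 x • Complex.exp (t * ((x ^ 2 / 2 : ℝ) : ℂ) * Complex.I)
      = ((√(2 * Real.pi))⁻¹ : ℝ) * Complex.exp (-((1 - t * Complex.I) / 2) * x ^ 2) := by
    rw [gaussianPDFReal, Complex.real_smul]
    push_cast
    rw [mul_assoc, ← Complex.exp_add]
    ring_nf
  have hπ : (((√(2 * Real.pi))⁻¹ : ℝ) : ℂ) ^ 2 = 1 / (2 * Real.pi) := by
    rw [← Complex.ofReal_pow, inv_pow, Real.sq_sqrt (by positivity)]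
    push_cast
    rw [one_div]
  have hne : (1 - t * Complex.I) ≠ 0 := fun h => by simp [h] at hre
  have hπ0 : (Real.pi : ℂ) ≠ 0 := Complex.ofReal_ne_zero.mpr Real.pi_ne_zero
  rw [charFun_apply_real, integral_map (by fun_prop) (by fun_prop),
    integral_gaussianReal_eq_integral_smul one_ne_zero]
  simp_rw [hexp]
  rw [integral_const_mul, mul_pow, hπ, integral_gaussian_sq_complex hre]
  field_simp

variable {Ω' : Type*} [MeasurableSpace Ω'] {ν : Measure Ω'}

lemma hasLaw_half_sq_add_sq {X Y : Ω' → ℝ} (hX : HasLaw X (gaussianReal 0 1) ν)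
    (hY : HasLaw Y (gaussianReal 0 1) ν) (hXY : IndepFun X Y ν) :
    HasLaw (fun ω => (X ω ^ 2 + Y ω ^ 2) / 2) (expMeasure 1) ν where
  aemeasurable := by fun_prop
  map_eq := by
    have := hX.isProbabilityMeasure
    have := isProbabilityMeasure_expMeasure one_pos
    have hmeas : Measurable fun x : ℝ => x ^ 2 / 2 := by fun_prop
    have hind := hXY.comp hmeas hmeas
    have hmap {Z : Ω' → ℝ} (hZ : HasLaw Z (gaussianReal 0 1) ν) :
        ν.map ((fun x => x ^ 2 / 2) ∘ Z) = (gaussianReal 0 1).map fun x => x ^ 2 / 2 := by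
      rw [← hZ.map_eq, AEMeasurable.map_map_of_aemeasurable (by fun_prop) hZ.aemeasurable]
    have hsum : (fun ω => (X ω ^ 2 + Y ω ^ 2) / 2)
        = (fun x => x ^ 2 / 2) ∘ X + (fun x => x ^ 2 / 2) ∘ Y := funext fun ω => add_div _ _ _
    refine Measure.ext_of_charFun (funext fun t => ?_)
    rw [hsum, hind.charFun_map_add_eq_mul (by fun_prop) (by fun_prop), hmap hX, hmap hY,
      Pi.mul_apply, ← sq, sq_charFun_map_half_sq_gaussianReal, charFun_expMeasure one_pos,
      Complex.ofReal_one]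

end ExponentialLaw

section WhiteNoise

variable {Ω' ι κ : Type*} [MeasurableSpace Ω'] {ν : Measure Ω'} [Fintype ι] {N : ι → Ω' → ℝ}

lemma hasGaussianLaw_sum_mul [Finite κ] (hN : iIndepFun N ν)
    (hN' : ∀ i, HasGaussianLaw (N i) ν) (A : κ → ι → ℝ) :
    HasGaussianLaw (fun ω a => ∑ l, A a l * N l ω) ν := by
  have := Fintype.ofFinite κ
  convert! (hN.hasGaussianLaw hN').map_fun
    (Matrix.mulVecLin (Matrix.of A)).toContinuousLinearMap using 2

lemma covariance_sum_mul_sum_mul (hN : iIndepFun N ν)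
    (hN' : ∀ i, HasLaw (N i) (gaussianReal 0 1) ν) (a b : ι → ℝ) :
    cov[fun ω => ∑ l, a l * N l ω, fun ω => ∑ l, b l * N l ω; ν] = ∑ l, a l * b l := by
  classical
  have := hN.isProbabilityMeasure
  have hL (l : ι) : MemLp (N l) 2 ν := (hN' l).hasGaussianLaw.memLp_two
  have hcov (l m : ι) : cov[N l, N m; ν] = if l = m then 1 else 0 := by
    split_ifs with h
    · rw [← h, covariance_self (hL l).aemeasurable, (hN' l).variance_eq, variance_id_gaussianReal,
        NNReal.coe_one]
    · exact (hN.indepFun h).covariance_eq_zero (hL l) (hL m)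
  rw [covariance_fun_sum_fun_sum (fun l => (hL l).const_mul _) (fun l => (hL l).const_mul _)]
  simp_rw [covariance_const_mul_left, covariance_const_mul_right, hcov]
  simp only [mul_ite, mul_one, mul_zero, Finset.sum_ite_eq, Finset.mem_univ, if_true]

lemma hasLaw_sum_mul_of_sum_sq_eq_one (hN : iIndepFun N ν)
    (hN' : ∀ i, HasLaw (N i) (gaussianReal 0 1) ν) {a : ι → ℝ} (ha : ∑ l, a l * a l = 1) :
    HasLaw (fun ω => ∑ l, a l * N l ω) (gaussianReal 0 1) ν := by
  have hG : HasGaussianLaw (fun ω => ∑ l, a l * N l ω) ν :=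
    (hasGaussianLaw_sum_mul hN (fun i => (hN' i).hasGaussianLaw) fun _ : Unit => a).eval ()
  have hmean : ∫ ω, ∑ l, a l * N l ω ∂ν = 0 := by
    rw [integral_finsetSum _ fun l _ => (hN' l).hasGaussianLaw.integrable.const_mul _]
    simp only [integral_const_mul, (hN' _).integral_eq, integral_id_gaussianReal, mul_zero,
      Finset.sum_const_zero]
  refine ⟨hG.aemeasurable, ?_⟩
  rw [hG.map_eq_gaussianReal, hmean, ← covariance_self hG.aemeasurable,
    covariance_sum_mul_sum_mul hN hN', ha, Real.toNNReal_one]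

lemma iIndepFun_sum_mul_of_orthogonal [Finite κ] (hN : iIndepFun N ν)
    (hN' : ∀ i, HasLaw (N i) (gaussianReal 0 1) ν) {A : κ → ι → ℝ}
    (hA : Pairwise fun a b => ∑ l, A a l * A b l = 0) :
    iIndepFun (fun a ω => ∑ l, A a l * N l ω) ν := by
  refine (hasGaussianLaw_sum_mul hN (fun i => (hN' i).hasGaussianLaw) A
    ).iIndepFun_of_covariance_eq_zero fun a b hab => ?_
  rw [covariance_sum_mul_sum_mul hN hN', hA hab]

end WhiteNoise

section PeriodogramOfNoise

variable {Ω' : Type*} [MeasurableSpace Ω'] {ν : Measure Ω'} {d : ℕ} {N : Fin d → Ω' → ℝ}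

lemma sum_normalized_trigVec (a b : Fin (numFreq d) × Bool) :
    ∑ l, (√(2 / (d : ℝ)) * trigVec d a l) * (√(2 / (d : ℝ)) * trigVec d b l)
      = if a = b then 1 else 0 := by
  have hd : (0 : ℝ) < d := Nat.cast_pos.mpr (by have := two_mul_succ_lt a.1; omega)
  have hmul (l : Fin d) : (√(2 / (d : ℝ)) * trigVec d a l) * (√(2 / (d : ℝ)) * trigVec d b l)
      = 2 / d * (trigVec d a l * trigVec d b l) := by
    rw [mul_mul_mul_comm, Real.mul_self_sqrt (by positivity)]
  rw [Finset.sum_congr rfl fun l _ => hmul l, ← Finset.mul_sum, sum_trigVec_mul_trigVec, mul_ite,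
    mul_zero]
  field_simp

lemma periodogram_eq_half_sq_add_sq (x : Fin d → ℝ) (j : Fin (numFreq d)) :
    periodogram x (j + 1) = ((∑ l, (√(2 / (d : ℝ)) * trigVec d (j, true) l) * x l) ^ 2
      + (∑ l, (√(2 / (d : ℝ)) * trigVec d (j, false) l) * x l) ^ 2) / 2 := by
  simp_rw [periodogram_eq, mul_assoc, ← Finset.mul_sum, mul_pow,
    Real.sq_sqrt (by positivity : 0 ≤ 2 / (d : ℝ))]
  ring

lemma hasLaw_periodogram (hN : iIndepFun N ν) (hN' : ∀ i, HasLaw (N i) (gaussianReal 0 1) ν) :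
    HasLaw (fun ω (j : Fin (numFreq d)) => periodogram (fun i => N i ω) (j + 1))
      (Measure.pi fun _ => expMeasure 1) ν := by
  set U := fun (a : Fin (numFreq d) × Bool) ω =>
    ∑ l, (√(2 / (d : ℝ)) * trigVec d a l) * N l ω
  have hU (a) : HasLaw (U a) (gaussianReal 0 1) ν :=
    hasLaw_sum_mul_of_sum_sq_eq_one hN hN' (by rw [sum_normalized_trigVec, if_pos rfl])
  have hind : iIndepFun U ν := iIndepFun_sum_mul_of_orthogonal hN hN' fun a b hab =>
    (sum_normalized_trigVec a b).trans (if_neg hab)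
  have hpair : iIndepFun (fun (j : Fin (numFreq d)) ω =>
      (U (j, true) ω ^ 2 + U (j, false) ω ^ 2) / 2) ν :=
    (iIndepFun_curry hind fun a => (hU a).aemeasurable).comp
      (fun _ u => (u true ^ 2 + u false ^ 2) / 2) fun _ => by fun_prop
  have hlaw (j : Fin (numFreq d)) :
      HasLaw (fun ω => (U (j, true) ω ^ 2 + U (j, false) ω ^ 2) / 2) (expMeasure 1) ν :=
    hasLaw_half_sq_add_sq (hU _) (hU _) (hind.indepFun (by simp))
  simp_rw [periodogram_eq_half_sq_add_sq]
  exact hpair.hasLaw_pi hlaw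

end PeriodogramOfNoise

section FisherFormula

lemma pi_withDensity_ofReal {ι : Type*} [Fintype ι] {α : ι → Type*} [∀ i, MeasurableSpace (α i)]
    {μ : ∀ i, Measure (α i)} [∀ i, SigmaFinite (μ i)] {f : ∀ i, α i → ℝ}
    (hf : ∀ i, Integrable (f i) (μ i)) (hf' : ∀ i x, 0 ≤ f i x) :
    Measure.pi (fun i => (μ i).withDensity fun x => ENNReal.ofReal (f i x))
      = (Measure.pi μ).withDensity fun x => ENNReal.ofReal (∏ i, f i (x i)) := by
  have (i : ι) := isFiniteMeasure_withDensity_ofReal (hf i).2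
  refine Measure.pi_eq fun s hs => ?_
  have hfs (i : ι) : Integrable (f i) ((μ i).restrict (s i)) := (hf i).mono_measure
    Measure.restrict_le_self
  rw [withDensity_apply _ (.univ_pi hs), Measure.restrict_pi_pi,
    ← ofReal_integral_eq_lintegral_ofReal (.fintype_prod_dep hfs)
      (.of_forall fun x => Finset.prod_nonneg fun i _ => hf' i (x i)),
    integral_fintype_prod_eq_prod,
    ENNReal.ofReal_prod_of_nonneg fun i _ => integral_nonneg (hf' i)]
  refine Finset.prod_congr rfl fun i _ => ?_
  rw [withDensity_apply _ (hs i),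
    ofReal_integral_eq_lintegral_ofReal (hfs i) (.of_forall (hf' i))]

variable {ι : Type*} [Fintype ι] {r : ℝ}

lemma pi_expMeasure_apply (hr : 0 < r) {B : Set (ι → ℝ)} (hB : MeasurableSet B) :
    Measure.pi (fun _ => expMeasure r) B = ∫⁻ x in B ∩ Set.univ.pi fun _ => Set.Ioi 0,
      ENNReal.ofReal (r ^ Fintype.card ι * Real.exp (-(r * ∑ i, x i))) := by
  have hpdf : IntegrableOn (fun x => r * Real.exp (-(r * x))) (Set.Ioi 0) := by
    simp_rw [← neg_mul]
    exact (integrableOn_exp_mul_Ioi (neg_lt_zero.mpr hr) 0).const_mul r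
  simp_rw [expMeasure_eq_withDensity]
  rw [pi_withDensity_ofReal (fun _ => hpdf) fun _ _ => by positivity, withDensity_apply _ hB,
    ← Measure.restrict_pi_pi, Measure.restrict_restrict hB, volume_pi]
  simp_rw [Finset.prod_mul_distrib, ← Real.exp_sum, Finset.sum_neg_distrib, ← Finset.mul_sum,
    Finset.prod_const, Finset.card_univ]

/-- The event that each coordinate with index in `J` exceeds `k` times the sum of all
coordinates. -/
def exceedSet (J : Finset ι) (k : ℝ) : Set (ι → ℝ) := ⋂ i ∈ J, {x | k * ∑ l, x l < x i}

lemma measurableSet_mul_sum_lt (k : ℝ) (i : ι) :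
    MeasurableSet {x : ι → ℝ | k * ∑ l, x l < x i} :=
  measurableSet_lt (by fun_prop) (by fun_prop)

lemma measurableSet_exceedSet (J : Finset ι) (k : ℝ) : MeasurableSet (exceedSet J k) :=
  J.measurableSet_biInter fun i _ => measurableSet_mul_sum_lt k i

/-- The linear map `x ↦ (x - k (∑ᵢ xᵢ) 1_J) / (1 - |J| k)`. It preserves coordinate sums and, inside
the positive orthant, turns the conditions `k ∑ᵢ xᵢ < xⱼ`, `j ∈ J`, into positivity. -/
noncomputable def exceedMap (J : Finset ι) (k : ℝ) : (ι → ℝ) →ₗ[ℝ] ι → ℝ :=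
  (1 - J.card * k)⁻¹ • LinearMap.transvection (∑ l, LinearMap.proj l)
    ((J : Set ι).indicator fun _ => -k)

lemma exceedMap_apply (J : Finset ι) (k : ℝ) (x : ι → ℝ) (i : ι) :
    exceedMap J k x i
      = (1 - J.card * k)⁻¹ * (x i - (J : Set ι).indicator (fun _ => k * ∑ l, x l) i) := by
  by_cases hi : i ∈ J
  · simp [exceedMap, LinearMap.transvection.apply, hi, sub_eq_add_neg, mul_comm k]
  · simp [exceedMap, LinearMap.transvection.apply, hi]

variable {J : Finset ι} {k : ℝ}

lemma sum_exceedMap (hJ : J.card * k < 1) (x : ι → ℝ) : ∑ i, exceedMap J k x i = ∑ i, x i := by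
  have hne : 1 - J.card * k ≠ 0 := by linarith
  simp_rw [exceedMap_apply, ← Finset.mul_sum, Finset.sum_sub_distrib,
    Finset.sum_indicator_subset _ J.subset_univ, Finset.sum_const, nsmul_eq_mul]
  field_simp

lemma det_exceedMap [Nonempty ι] (hJ : J.card * k < 1) :
    LinearMap.det (exceedMap J k) = ((1 - J.card * k) ^ (Fintype.card ι - 1))⁻¹ := by
  have hne : 1 - J.card * k ≠ 0 := by linarith
  have hdet : 1 + (∑ l, LinearMap.proj l : Module.Dual ℝ (ι → ℝ))
      ((J : Set ι).indicator fun _ => -k) = 1 - J.card * k := by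
    simp [LinearMap.sum_apply, Finset.sum_indicator_subset, sub_eq_add_neg]
  obtain ⟨n, hn⟩ := Nat.exists_eq_add_one.mpr (Fintype.card_pos (α := ι))
  rw [exceedMap, LinearMap.det_smul, LinearMap.transvection.det, hdet,
    Module.finrank_fintype_fun_eq_card, hn, pow_succ, mul_assoc, inv_mul_cancel₀ hne, mul_one,
    inv_pow, Nat.add_sub_cancel]

lemma exceedSet_inter_posOrthant [Nonempty ι] (hk : 0 ≤ k) (hJ : J.card * k < 1) :
    exceedSet J k ∩ Set.univ.pi (fun _ => Set.Ioi 0)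
      = exceedMap J k ⁻¹' Set.univ.pi fun _ => Set.Ioi 0 := by
  have hc : 0 < (1 - J.card * k)⁻¹ := inv_pos.mpr (by linarith)
  ext x
  simp only [exceedSet, Set.mem_inter_iff, Set.mem_iInter, Set.mem_ofPred_eq, Set.mem_univ_pi,
    Set.mem_Ioi, Set.mem_preimage]
  constructor
  · rintro ⟨hx, hx'⟩ i
    rw [exceedMap_apply]
    refine mul_pos hc (sub_pos.mpr ?_)
    by_cases hi : i ∈ J
    · simpa [hi] using hx i hi
    · simpa [hi] using hx' i
  · intro h
    have hsum : 0 < ∑ i, x i :=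
      sum_exceedMap hJ x ▸ Finset.sum_pos (fun i _ => h i) Finset.univ_nonempty
    have hind (i) : (J : Set ι).indicator (fun _ => k * ∑ l, x l) i < x i :=
      sub_pos.mp (pos_of_mul_pos_right (exceedMap_apply J k x i ▸ h i) hc.le)
    refine ⟨fun i hi => ?_, fun i => (Set.indicator_nonneg (fun _ _ => ?_) i).trans_lt (hind i)⟩
    · simpa [hi] using hind i
    · positivity

lemma pi_expMeasure_exceedSet_of_lt [Nonempty ι] (hr : 0 < r) (hk : 0 ≤ k) (hJ : J.card * k < 1) :
    Measure.pi (fun _ => expMeasure r) (exceedSet J k)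
      = ENNReal.ofReal ((1 - J.card * k) ^ (Fintype.card ι - 1)) := by
  have hc : 0 < (1 - J.card * k) := by linarith
  have hdet : LinearMap.det (exceedMap J k) ≠ 0 := by rw [det_exceedMap hJ]; positivity
  have := isProbabilityMeasure_expMeasure hr
  have hone := pi_expMeasure_apply (ι := ι) hr .univ
  rw [measure_univ, Set.univ_inter] at hone
  rw [pi_expMeasure_apply hr (measurableSet_exceedSet J k), exceedSet_inter_posOrthant hk hJ]
  let φ (x : ι → ℝ) := ENNReal.ofReal (r ^ Fintype.card ι * Real.exp (-(r * ∑ i, x i)))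
  calc ∫⁻ x in exceedMap J k ⁻¹' Set.univ.pi fun _ => Set.Ioi 0, φ x
    _ = ∫⁻ x in exceedMap J k ⁻¹' Set.univ.pi fun _ => Set.Ioi 0, φ (exceedMap J k x) := by
        simp only [φ, sum_exceedMap hJ]
    _ = ∫⁻ x in Set.univ.pi fun _ => Set.Ioi 0, φ x ∂volume.map (exceedMap J k) :=
        (setLIntegral_map (.univ_pi fun _ => measurableSet_Ioi) (by fun_prop)
          (exceedMap J k).continuous_of_finiteDimensional.measurable).symm
    _ = ENNReal.ofReal ((1 - J.card * k) ^ (Fintype.card ι - 1)) := by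
        rw [Real.map_linearMap_volume_pi_eq_smul_volume_pi hdet, Measure.restrict_smul,
          lintegral_smul_measure, ← hone, det_exceedMap hJ, inv_inv, abs_of_pos (pow_pos hc _),
          smul_eq_mul, mul_one]

lemma pi_expMeasure_exceedSet_of_le (hr : 0 < r) (hJn : J.Nonempty) (hJ : 1 ≤ J.card * k) :
    Measure.pi (fun _ => expMeasure r) (exceedSet J k) = 0 := by
  suffices hempty : exceedSet J k ∩ Set.univ.pi (fun _ => Set.Ioi 0) = ∅ by
    rw [pi_expMeasure_apply hr (measurableSet_exceedSet J k), hempty, setLIntegral_empty]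
  refine Set.eq_empty_of_forall_notMem fun x ⟨hx, hx'⟩ => ?_
  simp only [exceedSet, Set.mem_iInter, Set.mem_ofPred_eq, Set.mem_univ_pi, Set.mem_Ioi] at hx hx'
  have hS : 0 ≤ ∑ i, x i := Finset.sum_nonneg fun i _ => (hx' i).le
  have hlt := calc ∑ i, x i
    _ ≤ J.card * k * ∑ i, x i := le_mul_of_one_le_left hS hJ
    _ = ∑ _ ∈ J, k * ∑ i, x i := by rw [Finset.sum_const, nsmul_eq_mul, mul_assoc]
    _ < ∑ i ∈ J, x i := Finset.sum_lt_sum_of_nonempty hJn hx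
    _ ≤ ∑ i, x i := Finset.sum_le_univ_sum_of_nonneg fun i => (hx' i).le
  exact hlt.false

lemma pi_expMeasure_real_exceedSet (hι : 2 ≤ Fintype.card ι) (hr : 0 < r) (hk : 0 ≤ k)
    (hJn : J.Nonempty) :
    (Measure.pi fun _ => expMeasure r).real (exceedSet J k)
      = (max (1 - J.card * k) 0) ^ (Fintype.card ι - 1) := by
  have : Nonempty ι := Fintype.card_pos_iff.mp (by omega)
  rcases lt_or_ge ((J.card : ℝ) * k) 1 with h | h
  · rw [Measure.real, pi_expMeasure_exceedSet_of_lt hr hk h, max_eq_left (by linarith),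
      ENNReal.toReal_ofReal (pow_nonneg (by linarith) _)]
  · rw [Measure.real, pi_expMeasure_exceedSet_of_le hr hJn h, max_eq_right (by linarith),
      zero_pow (by omega), ENNReal.toReal_zero]

lemma pi_expMeasure_real_exists_mul_sum_lt (hι : 2 ≤ Fintype.card ι) (hr : 0 < r) (hk : 0 ≤ k) :
    (Measure.pi fun _ => expMeasure r).real {x : ι → ℝ | ∃ i, k * ∑ l, x l < x i}
      = fisherTail (Fintype.card ι) k := by
  have := isProbabilityMeasure_expMeasure hr
  let F : ℕ → ℝ := fun j => if j = 0 then 0 else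
    (-1) ^ (j + 1) * max (1 - j * k) 0 ^ (Fintype.card ι - 1)
  have hU : {x : ι → ℝ | ∃ i, k * ∑ l, x l < x i}
      = ⋃ i ∈ (Finset.univ : Finset ι), {x | k * ∑ l, x l < x i} := by
    ext x; simp only [Set.mem_ofPred_eq, Set.mem_iUnion, Finset.mem_univ, exists_const]
  calc (Measure.pi fun _ => expMeasure r).real {x : ι → ℝ | ∃ i, k * ∑ l, x l < x i}
    _ = ∑ J : Finset ι with J.Nonempty, (-1 : ℝ) ^ (J.card + 1)
          * (Measure.pi fun _ => expMeasure r).real (exceedSet J k) := by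
        rw [hU, measureReal_biUnion_eq_sum_powerset fun i _ => measurableSet_mul_sum_lt k i,
          Finset.powerset_univ]
        rfl
    _ = ∑ J : Finset ι, F J.card := by
        rw [Finset.sum_filter]
        refine Finset.sum_congr rfl fun J _ => ?_
        rcases J.eq_empty_or_nonempty with rfl | hJ
        · simp [F]
        · rw [if_pos hJ, pi_expMeasure_real_exceedSet hι hr hk hJ]
          simp only [F, hJ.card_ne_zero, if_false]
    _ = ∑ j ∈ Finset.range (Fintype.card ι + 1), (Fintype.card ι).choose j • F j := by
        rw [← Finset.powerset_univ, Finset.sum_powerset_apply_card, Finset.card_univ]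
    _ = fisherTail (Fintype.card ι) k := by
        rw [Finset.sum_range_eq_add_Ico _ (Nat.succ_pos _), fisherTail]
        simp only [F, if_true, smul_zero, zero_add]
        refine Finset.sum_congr rfl fun j hj => ?_
        rw [if_neg (by have := (Finset.mem_Icc.mp hj).1; omega), nsmul_eq_mul]
        ring

lemma continuous_fisherTail (q : ℕ) : Continuous (fisherTail q) := by
  unfold fisherTail
  fun_prop

lemma sum_alternating_choose_mul_eval_eq_zero {R : Type*} [CommRing R] {P : Polynomial R} {n : ℕ}
    (hP : P.natDegree < n) :
    ∑ j ∈ Finset.range (n + 1), (-1) ^ j * (n.choose j : R) * P.eval (j : R) = 0 := by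
  have h := congrFun (Polynomial.fwdDiff_iter_eq_zero_of_degree_lt hP) 0
  rw [fwdDiff_iter_eq_sum_shift, Pi.zero_apply] at h
  rw [← mul_zero ((-1 : R) ^ n), ← h, Finset.mul_sum]
  refine Finset.sum_congr rfl fun j hj => ?_
  obtain ⟨m, rfl⟩ := Nat.exists_eq_add_of_le (Finset.mem_range_succ_iff.mp hj)
  have hsign : (-1 : R) ^ (j + m) * (-1) ^ m = (-1) ^ j := by
    rw [pow_add, mul_assoc, ← mul_pow, neg_one_mul, neg_neg, one_pow, mul_one]
  rw [Nat.add_sub_cancel_left, zsmul_eq_mul, zero_add, nsmul_one, ← hsign]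
  push_cast
  ring

lemma fisherTail_eq_one_of_nonpos {q : ℕ} (hq : 0 < q) (hk : k ≤ 0) : fisherTail q k = 1 := by
  set P : Polynomial ℝ := (1 - Polynomial.C k * Polynomial.X) ^ (q - 1) with hP
  have hdeg : P.natDegree < q := by
    have h : (1 - Polynomial.C k * Polynomial.X : Polynomial ℝ).natDegree ≤ 1 := by compute_degree
    have hpow : P.natDegree ≤ (q - 1) * 1 := Polynomial.natDegree_pow_le_of_le (q - 1) h
    omega
  have hterm (j : ℕ) : (-1 : ℝ) ^ (j + 1) * q.choose j * max (1 - j * k) 0 ^ (q - 1)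
      = -((-1) ^ j * q.choose j * P.eval (j : ℝ)) := by
    have hnonneg : 0 ≤ 1 - j * k := by
      linarith [mul_nonpos_of_nonneg_of_nonpos (Nat.cast_nonneg (α := ℝ) j) hk]
    have heval : P.eval (j : ℝ) = (1 - j * k) ^ (q - 1) := by simp [hP, mul_comm k]
    rw [heval, max_eq_left hnonneg]
    ring
  have hsum := sum_alternating_choose_mul_eval_eq_zero hdeg
  rw [Finset.sum_range_eq_add_Ico _ (Nat.succ_pos q)] at hsum
  have hzero : P.eval ((0 : ℕ) : ℝ) = 1 := by simp [hP]
  rw [hzero, pow_zero, Nat.choose_zero_right, Nat.cast_one, one_mul, one_mul] at hsum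
  rw [fisherTail, Finset.sum_congr rfl fun j _ => hterm j, Finset.sum_neg_distrib]
  exact (eq_neg_of_add_eq_zero_left hsum).symm

end FisherFormula

section FisherStatisticOfNoise

variable {Ω' : Type*} [MeasurableSpace Ω'] {ν : Measure Ω'} {d : ℕ} {N : Fin d → Ω' → ℝ}

lemma measure_eq_eq_zero_of_continuous_tail [IsFiniteMeasure ν] {X : Ω' → ℝ}
    (hX : AEMeasurable X ν) (hcont : Continuous fun k => ν.real {ω | X ω > k}) (k : ℝ) :
    ν {ω | X ω = k} = 0 := by
  have hbound (k') (hk' : k' < k) :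
      ν.real {ω | X ω = k} ≤ ν.real {ω | X ω > k'} - ν.real {ω | X ω > k} := by
    have hdisj : Disjoint {ω | X ω = k} {ω | X ω > k} :=
      Set.disjoint_left.mpr fun ω hω hω' => (ne_of_gt hω') hω
    rw [le_sub_iff_add_le,
      ← measureReal_union₀ (nullMeasurableSet_lt aemeasurable_const hX) hdisj.aedisjoint]
    exact measureReal_mono fun ω => Or.rec (fun hω => hk'.trans_eq (Eq.symm hω)) hk'.trans
  have hlim : Tendsto (fun k' => ν.real {ω | X ω > k'} - ν.real {ω | X ω > k}) (𝓝[<] k) (𝓝 0) :=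
    (tendsto_sub_nhds_zero_iff.mpr (hcont.tendsto k)).mono_left nhdsWithin_le_nhds
  have hle := ge_of_tendsto hlim (eventually_nhdsWithin_of_forall hbound)
  exact (measureReal_eq_zero_iff (measure_ne_top _ _)).mp (hle.antisymm measureReal_nonneg)

lemma ae_notMem_vanishingSet (hN : iIndepFun N ν) (hN' : ∀ i, HasLaw (N i) (gaussianReal 0 1) ν)
    (hq : 0 < numFreq d) : ∀ᵐ ω ∂ν, (fun i => N i ω) ∉ vanishingSet d := by
  have hlaw := hasLaw_periodogram hN hN'
  have := isProbabilityMeasure_expMeasure one_pos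
  have : NullSingletonClass (expMeasure 1) := by rw [expMeasure_eq_withDensity]; infer_instance
  have hne : ∀ᵐ x ∂Measure.pi fun _ : Fin (numFreq d) => expMeasure 1, x ⟨0, hq⟩ ≠ 0 :=
    Measure.ae_eval_ne (fun _ => expMeasure 1) (⟨0, hq⟩ : Fin (numFreq d)) 0
  rw [← hlaw.map_eq] at hne
  filter_upwards [ae_of_ae_map hlaw.aemeasurable hne] with ω hω hmem
  exact hω (hmem 1 (Finset.mem_Icc.mpr ⟨le_rfl, hq⟩))

lemma measureReal_fisherG_gt (hN : iIndepFun N ν) (hN' : ∀ i, HasLaw (N i) (gaussianReal 0 1) ν)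
    (hq : 2 ≤ numFreq d) (k : ℝ) :
    ν.real {ω | fisherG (fun i => N i ω) > k} = fisherTail (numFreq d) k := by
  have := hN.isProbabilityMeasure
  rcases lt_or_ge k 0 with hk | hk
  · have huniv : {ω | fisherG (fun i => N i ω) > k} = Set.univ :=
      Set.eq_univ_of_forall fun ω => hk.trans_le (fisherG_nonneg _)
    rw [fisherTail_eq_one_of_nonpos (by omega) hk.le, huniv, probReal_univ]
  · have hlaw := hasLaw_periodogram hN hN'
    have hmeas : MeasurableSet {x : Fin (numFreq d) → ℝ | ∃ i, k * ∑ l, x l < x i} :=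
      Set.ofPred_exists _ ▸ .iUnion (measurableSet_mul_sum_lt k)
    calc ν.real {ω | fisherG (fun i => N i ω) > k}
      _ = ν.real {ω | ∃ i : Fin (numFreq d), k * ∑ l : Fin (numFreq d),
            periodogram (fun i => N i ω) (l + 1) < periodogram (fun i => N i ω) (i + 1)} := by
          refine measureReal_congr ?_
          filter_upwards [ae_notMem_vanishingSet hN hN' (by omega)] with ω hω
          exact propext (lt_fisherG_iff hω k)
      _ = (Measure.pi fun _ => expMeasure 1).real
            {x : Fin (numFreq d) → ℝ | ∃ i, k * ∑ l, x l < x i} := hlaw.measureReal_eq hmeas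
      _ = fisherTail (numFreq d) k := by
          rw [pi_expMeasure_real_exists_mul_sum_lt (by rwa [Fintype.card_fin]) one_pos hk,
            Fintype.card_fin]

lemma measure_fisherG_eq (hN : iIndepFun N ν) (hN' : ∀ i, HasLaw (N i) (gaussianReal 0 1) ν)
    (hq : 2 ≤ numFreq d) (k : ℝ) : ν {ω | fisherG (fun i => N i ω) = k} = 0 := by
  have := hN.isProbabilityMeasure
  refine measure_eq_eq_zero_of_continuous_tail (measurable_fisherG.comp_aemeasurable
    (aemeasurable_pi_lambda _ fun i => (hN' i).aemeasurable)) ?_ k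
  exact (continuous_fisherTail _).congr fun k => (measureReal_fisherG_gt hN hN' hq k).symm

end FisherStatisticOfNoise

namespace IsPeriodicSeries

variable {Ω Ω' : Type*} [MeasurableSpace Ω] [MeasurableSpace Ω'] {μ : Measure Ω} {ν : Measure Ω'}
  {Y : ℕ → Ω → ℝ} {r d : ℕ} {N : Fin d → Ω' → ℝ}

lemma exists_limitVariance_eq_sq (hY : IsPeriodicSeries μ Y r) (hvar : ∃ ℓ, Var[Y ℓ; μ] ≠ 0)
    (hrd : Nat.Coprime r d) : ∃ σ : ℝ, σ ≠ 0 ∧ ∀ i, limitVariance μ Y r d i = σ ^ 2 := by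
  obtain ⟨ℓ, hℓ⟩ := hvar
  rw [← hY.periodic_variance.map_mod_nat] at hℓ
  have hr : (0 : ℝ) < r := Nat.cast_pos.mpr hY.pos
  have hpos : 0 < 1 / (r : ℝ) * ∑ k ∈ Finset.range r, Var[Y k; μ] :=
    mul_pos (one_div_pos.mpr hr) (Finset.sum_pos' (fun k _ => variance_nonneg _ _)
      ⟨ℓ % r, Finset.mem_range.mpr (Nat.mod_lt _ hY.pos), (variance_nonneg _ _).lt_of_ne' hℓ⟩)
  refine ⟨_, (Real.sqrt_pos.mpr hpos).ne', fun i => ?_⟩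
  rw [hY.limitVariance_eq_average hrd, Real.sq_sqrt hpos.le]

lemma fisherG_sqrt_mul_blockMean_sub (hY : IsPeriodicSeries μ Y r) (hrd : Nat.Coprime r d) (n : ℕ)
    (ω : Ω) :
    fisherG (fun i => √((n / d : ℕ) : ℝ)
      * (blockMean Y d n ω i - limitMean (fun ℓ => ∫ ω, Y ℓ ω ∂μ) r d i))
        = fisherG (blockMean Y d n ω) := by
  rcases Nat.eq_zero_or_pos (n / d) with h | h
  · have hzero : blockMean Y d n ω = fun _ => 0 := funext fun i => by simp [blockMean, h]
    simp only [h, Nat.cast_zero, Real.sqrt_zero, zero_mul, hzero]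
  · rw [limitMean_eq_average_of_coprime hY.pos hY.periodic_integral hrd]
    exact fisherG_mul_sub_const _ (by positivity) _

lemma tendstoInDistribution_fisherF [IsProbabilityMeasure μ] [IsProbabilityMeasure ν]
    (hY : IsPeriodicSeries μ Y r) (hvar : ∃ ℓ, Var[Y ℓ; μ] ≠ 0) (hd : 0 < d)
    (hrd : Nat.Coprime r d) (hN : iIndepFun N ν) (hN' : ∀ i, HasLaw (N i) (gaussianReal 0 1) ν) :
    TendstoInDistribution (fun n ω => fisherF (blockMean Y d n ω)) atTop
      (fun ω => fisherG fun i => N i ω) (fun _ => μ) ν := by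
  simp_rw [fisherF_eq_fisherG]
  rcases Nat.eq_zero_or_pos (numFreq d) with hq | hq
  · simp_rw [fisherG_eq_zero_of_numFreq_eq_zero hq]
    exact tendstoInDistribution_of_identDistrib 0 (fun _ => .refl aemeasurable_const)
      ⟨aemeasurable_const, aemeasurable_const, by simp only [Measure.map_const, measure_univ]⟩
  obtain ⟨σ, hσ, hσv⟩ := hY.exists_limitVariance_eq_sq hvar hrd
  have hσN (i : Fin d) :
      HasLaw (fun ω => σ * N i ω) (gaussianReal 0 (limitVariance μ Y r d i).toNNReal) ν := by
    convert gaussianReal_const_mul (hN' i) σ using 2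
    · rw [mul_zero]
    · ext
      simp [hσv, sq_nonneg]
  have hblock := hY.tendstoInDistribution_blockMean (G := fun i ω => σ * N i ω) hd
    (hN.comp (fun _ x => σ * x) fun _ => by fun_prop) hσN
  have hcont : ∀ᵐ ω ∂ν, ContinuousAt fisherG fun i => σ * N i ω := by
    filter_upwards [ae_notMem_vanishingSet hN hN' hq] with ω hω
    exact continuousAt_fisherG (mt (mul_mem_vanishingSet_iff hσ).mp hω)
  have hlim := tendstoInDistribution_comp_of_ae_continuousAt hblock measurable_fisherG hcont
  have hscale (ω : Ω') : fisherG (fun i => σ * N i ω) = fisherG fun i => N i ω := by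
    simpa only [sub_zero] using fisherG_mul_sub_const (fun i => N i ω) hσ 0
  simpa only [hY.fisherG_sqrt_mul_blockMean_sub hrd, hscale] using hlim

end IsPeriodicSeries

lemma two_le_of_fisherTail_mem_Ioo {q : ℕ} {k : ℝ} (h : fisherTail q k ∈ Set.Ioo 0 1) : 2 ≤ q := by
  match q with
  | 0 => simp [fisherTail] at h
  | 1 => simp [fisherTail] at h
  | q + 2 => omega

section Binary

variable {Ω Ω' : Type*} [MeasurableSpace Ω] [MeasurableSpace Ω'] {μ : Measure Ω} {ν : Measure Ω'}

lemma measureReal_eq_zero_of_ae_eq_zero_or_one [IsProbabilityMeasure μ] {X : Ω → ℝ}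
    (hX : AEMeasurable X μ) (hb : ∀ᵐ ω ∂μ, X ω = 0 ∨ X ω = 1) :
    μ.real {ω | X ω = 0} = 1 - μ.real {ω | X ω = 1} := by
  have hXint : Integrable X μ := .of_bound hX.aestronglyMeasurable 1 (hb.mono fun ω hω => by
    rcases hω with h | h <;> simp [h])
  rw [← integral_one_sub_of_ae_eq_zero_or_one hX hb, ← integral_of_ae_eq_zero_or_one hX hb,
    integral_sub (integrable_const 1) hXint, integral_const, probReal_univ, one_smul]

lemma identDistrib_of_ae_eq_zero_or_one [IsProbabilityMeasure μ] [IsProbabilityMeasure ν]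
    {X : Ω → ℝ} {X' : Ω' → ℝ} (hX : AEMeasurable X μ) (hX' : AEMeasurable X' ν)
    (hb : ∀ᵐ ω ∂μ, X ω = 0 ∨ X ω = 1) (hb' : ∀ᵐ ω ∂ν, X' ω = 0 ∨ X' ω = 1)
    (hone : μ.real {ω | X ω = 1} = ν.real {ω | X' ω = 1}) : IdentDistrib X X' μ ν := by
  have hzero : μ.real {ω | X ω = 0} = ν.real {ω | X' ω = 0} := by
    rw [measureReal_eq_zero_of_ae_eq_zero_or_one hX hb,
      measureReal_eq_zero_of_ae_eq_zero_or_one hX' hb', hone]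
  refine ⟨hX, hX', ?_⟩
  rw [(Measure.ae_eq_or_eq_iff_map_eq_dirac_add_dirac hX zero_ne_one).mp hb,
    (Measure.ae_eq_or_eq_iff_map_eq_dirac_add_dirac hX' zero_ne_one).mp hb']
  exact congrArg₂ (fun a b => a • Measure.dirac (0 : ℝ) + b • Measure.dirac 1)
    ((measureReal_eq_measureReal_iff).mp hzero) ((measureReal_eq_measureReal_iff).mp hone)

end Binary

namespace IsPeriodicBinarySeries

variable {Ω : Type*} [MeasurableSpace Ω] {μ : Measure Ω} {Y : ℕ → Ω → ℝ} {p : ℕ → ℝ} {r : ℕ}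

lemma integral_eq (hY : IsPeriodicBinarySeries μ Y p r) (ℓ : ℕ) : ∫ ω, Y ℓ ω ∂μ = p ℓ := by
  rw [hY.prob_eq, integral_of_ae_eq_zero_or_one (hY.measurable ℓ).aemeasurable
    (.of_forall (hY.binary ℓ))]

lemma variance_ne_zero (hY : IsPeriodicBinarySeries μ Y p r) (ℓ : ℕ) : Var[Y ℓ; μ] ≠ 0 := by
  have := hY.indep.isProbabilityMeasure
  have hmeas := (hY.measurable ℓ).aemeasurable (μ := μ)
  have hb : ∀ᵐ ω ∂μ, Y ℓ ω = 0 ∨ Y ℓ ω = 1 := .of_forall (hY.binary ℓ)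
  rw [variance_of_ae_eq_zero_or_one hmeas hb, measureReal_eq_zero_of_ae_eq_zero_or_one hmeas hb,
    ← hY.prob_eq]
  exact (mul_pos (sub_pos.mpr (hY.prob_mem ℓ).2) (hY.prob_mem ℓ).1).ne'

lemma isPeriodicSeries (hY : IsPeriodicBinarySeries μ Y p r) : IsPeriodicSeries μ Y r where
  pos := hY.period.1.1
  indep := hY.indep
  memLp ℓ := by
    have := hY.indep.isProbabilityMeasure
    refine .of_bound (hY.measurable ℓ).aestronglyMeasurable 1 (.of_forall fun ω => ?_)
    rcases hY.binary ℓ ω with h | h <;> simp [h]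
  identDistrib ℓ := by
    have := hY.indep.isProbabilityMeasure
    have hperiod : p (ℓ + r) = p ℓ := by simpa [add_comm] using hY.period.1.2 ℓ 1
    refine identDistrib_of_ae_eq_zero_or_one (hY.measurable _).aemeasurable
      (hY.measurable _).aemeasurable (.of_forall (hY.binary _)) (.of_forall (hY.binary _)) ?_
    rw [← hY.prob_eq, ← hY.prob_eq, hperiod]

end IsPeriodicBinarySeries

theorem mainTheorem5_general {Ω Ω' : Type*} [MeasurableSpace Ω] [MeasurableSpace Ω']
    {μ : Measure Ω} [IsProbabilityMeasure μ] {ν : Measure Ω'} [IsProbabilityMeasure ν]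
    {Y : ℕ → Ω → ℝ} {r d : ℕ} {N : Fin d → Ω' → ℝ} (hY : IsPeriodicSeries μ Y r)
    (hvar : ∃ ℓ, Var[Y ℓ; μ] ≠ 0) (hd : 0 < d) (hrd : Nat.Coprime r d) (hN : iIndepFun N ν)
    (hN' : ∀ i, HasLaw (N i) (gaussianReal 0 1) ν) :
    limitMean (fun ℓ => ∫ ω, Y ℓ ω ∂μ) r d ∈ vanishingSet d ∧
    (∀ i : Fin d, Tendsto (fun n : ℕ => Var[fun ω => √((n / d : ℕ) : ℝ) * blockMean Y d n ω i; μ])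
      atTop (𝓝 (limitVariance μ Y r d i))) ∧
    (∀ i i' : Fin d, limitVariance μ Y r d i = limitVariance μ Y r d i') ∧
    (3 ≤ d → ∀ᵐ ω ∂ν, (fun i => N i ω) ∉ vanishingSet d) ∧
    TendstoInDistribution (fun (n : ℕ) ω => fisherF (blockMean Y d n ω)) atTop
      (fun ω => fisherG fun i => N i ω) (fun _ => μ) ν ∧
    (∀ α ∈ Set.Ioo (0 : ℝ) 1, ∀ k : ℝ, fisherTail (numFreq d) k = α →
      Tendsto (fun n : ℕ => μ.real {ω | fisherF (blockMean Y d n ω) > k}) atTop (𝓝 α)) := by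
  have hlim := hY.tendstoInDistribution_fisherF hvar hd hrd hN hN'
  refine ⟨?_, hY.tendsto_variance_sqrt_mul_blockMean hd, ?_, ?_, hlim, ?_⟩
  · rw [limitMean_eq_average_of_coprime hY.pos hY.periodic_integral hrd]
    exact const_mem_vanishingSet d _
  · simp only [hY.limitVariance_eq_average hrd, implies_true]
  · exact fun hd3 => ae_notMem_vanishingSet hN hN' (by unfold numFreq; omega)
  · rintro _ hα k rfl
    have hq := two_le_of_fisherTail_mem_Ioo hα
    rw [← measureReal_fisherG_gt hN hN' hq]
    exact tendsto_measureReal_gt_of_tendstoInDistribution hlim (measure_fisherG_eq hN hN' hq k)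

theorem mainTheorem5
    {Ω : Type*} [MeasurableSpace Ω] (μ : Measure Ω) [IsProbabilityMeasure μ]
    (Y : ℕ → Ω → ℝ) (p : ℕ → ℝ) (r d : ℕ)
    (hY : IsPeriodicBinarySeries μ Y p r) (hd : 0 < d) (hrd : Nat.Coprime r d)
    {Ω' : Type*} [MeasurableSpace Ω'] (ν : Measure Ω') [IsProbabilityMeasure ν]
    (N : Fin d → Ω' → ℝ) (hN : iIndepFun N ν) (hN' : ∀ i, HasLaw (N i) (gaussianReal 0 1) ν) :
    -- the vector of limits lies in `A`
    limitMean p r d ∈ vanishingSet d ∧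
    -- the `v_i` are the limiting variances, and they are all equal
    (∀ i : Fin d, Tendsto
      (fun n : ℕ => variance (fun ω => √((n / d : ℕ) : ℝ) * blockMean Y d n ω i) μ)
      atTop (𝓝 (limitVariance μ Y r d i))) ∧
    (∀ i i' : Fin d, limitVariance μ Y r d i = limitVariance μ Y r d i') ∧
    -- `g(N_1, …, N_d)` is almost surely well defined, and is the limit in law of `f(Z^n)`
    (3 ≤ d → ∀ᵐ ω ∂ν, (fun i => N i ω) ∉ vanishingSet d) ∧
    TendstoInDistribution (fun (n : ℕ) ω => fisherF (blockMean Y d n ω)) atTop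
      (fun ω => fisherG (fun i => N i ω)) (fun _ => μ) ν ∧
    -- the power of the test tends to its nominal level
    (∀ α ∈ Set.Ioo (0 : ℝ) 1, ∀ k : ℝ, fisherTail (numFreq d) k = α →
      Tendsto (fun n : ℕ => μ.real {ω | fisherF (blockMean Y d n ω) > k}) atTop (𝓝 α)) := by
  obtain rfl : (fun ℓ => ∫ ω, Y ℓ ω ∂μ) = p := funext hY.integral_eq
  exact mainTheorem5_general hY.isPeriodicSeries ⟨0, hY.variance_ne_zero 0⟩ hd hrd hN hN'
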